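/- For $n\ge 1$ write $[n]=\{1,\dots,n\}$. A family $\mathcal F\subseteq 2^{[n]}$ contains a poset $P$ if there is an injection $f:P\to\mathcal F$ such that $p\le_P p'$ implies $f(p)\subseteq f(p')$; otherwise $\mathcal F$ avoids $P$. Let $\mathcal P_5$ be the class of all $5$-element posets whose undirected Hasse diagram is a path, and let $\mathrm{La}(n,\mathcal P_5,\#P_2)$ be the maximum number of $2$-chains (pairs $A\subsetneq B$ with $A,B\in\mathcal F$) over all families $\mathcal F\subseteq 2^{[n]}$ that avoid every poset in $\mathcal P_5$. Then, for all sufficiently large $n$, $$\mathrm{La}(n,\mathcal P_5,\#P_2)=5\binom{n-2}{\lfloor n/2\rfloor-1}=\left(\frac54+o(1)\right)\binom{n}{\lfloor n/2\rfloor}\qquad(n\to\infty).$$ Moreover, for every $n\ge 2$ the family $\{F\subseteq[n] : |F\cap[n-2]|=\lfloor (n-2)/2\rfloor\}$ avoids every poset in $\mathcal P_5$ and contains exactly $5\binom{n-2}{\lfloor n/2\rfloor-1}$ two-element chains; in particular it attains the maximum for all sufficiently large $n$. -/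

import Mathlib

open Filter Topology

/-- A class of (finite) posets. -/
def PosetClass : Type 1 := ∀ P : Type, PartialOrder P → Prop

/-- The class of posets on `k` elements whose undirected Hasse diagram is a path:
the graph of the covering relation is isomorphic to the path graph on `k` vertices. -/
def pathPosets (k : ℕ) : PosetClass := fun P _ =>
  Nonempty (SimpleGraph.hasse P ≃g SimpleGraph.pathGraph k)

/-- The family `F` of subsets of an `n`-element set, ordered by inclusion, contains `P` as a
(weak) subposet: there is an injection from `P` into `F` that preserves the order. -/
def ContainsPoset {n : ℕ} (F : Finset (Finset (Fin n))) (P : Type) [PartialOrder P] : Prop :=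
  ∃ f : P → Finset (Fin n), Function.Injective f ∧ (∀ p, f p ∈ F) ∧
    ∀ p q : P, p ≤ q → f p ⊆ f q

/-- `F` contains no poset of the class `C` as a (weak) subposet. -/
def AvoidsClass {n : ℕ} (C : PosetClass) (F : Finset (Finset (Fin n))) : Prop :=
  ∀ (P : Type) (inst : PartialOrder P), C P inst → ¬ ContainsPoset F P

/-- The number of 2-chains (pairs `A ⊂ B` of members, strict inclusion) in `F`. -/
def numTwoChains {n : ℕ} (F : Finset (Finset (Fin n))) : ℕ :=
  ((F ×ˢ F).filter fun p => p.1 ⊂ p.2).card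

open Classical in
/-- `La(n, C, #P₂)`: the maximum number of 2-chains in a family of subsets of an `n`-element set
that avoids every poset of the class `C`. -/
noncomputable def maxTwoChains (n : ℕ) (C : PosetClass) : ℕ :=
  ((Finset.univ : Finset (Finset (Finset (Fin n)))).filter fun F => AvoidsClass C F).sup
    numTwoChains

/-- All `F ⊆ [n]` with `|F ∩ [n-2]| = ⌊(n-2)/2⌋`, where `[n-2]` consists of the first `n-2`
elements of the ground set (used for `n ≥ 2`). -/
def pairedMiddleFamily (n : ℕ) : Finset (Finset (Fin n)) :=
  Finset.univ.filter fun F => (F.filter fun i => i.val < n - 2).card = (n - 2) / 2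

/-!
A family avoids all five-element posets with a path as Hasse diagram if and only if its
comparability graph has no path on five vertices: the ups and downs along such a path generate a
poset of the class (`OrientedPath`). The 2-chains are the edges of this graph, so the upper bound
is a statement about its components.

Maximal chains of the Boolean lattice are encoded as permutations of the ground set. A chain that
meets the convex hulls of two components would create a comparability between them, so the hulls
of distinct components are met by disjoint sets of chains (`disjoint_hullChains`), and it suffices
that each component with `e` edges has a hull met by a proportion of at least `e / (5 M)` of all
chains, where `M` is the middle binomial coefficient of `n - 2`
(`card_component_mul_factorial_le`). The chains meeting an interval `[A, B]` are the permutations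
that place `A` before the complement of `B`; their proportion is the reciprocal of
`(n - #(B \ A)).choose #A`. Hence a pair `A ⊆ B` with `#(B \ A) ≥ 2` accounts for five edges, which is sharp
for a diamond; a pair with `#(B \ A) ≥ 3` accounts for six edges; and an antichain of size `s`
accounts for `5s/4` edges, as no level exceeds `4 M`. A set comparable to all members of a small
antichain adds almost one more unit of weight, because few chains pass through two given sets
(`claw_weight`).

Components without a path on five vertices are very restricted (`component_structure`). A complete
graph on four vertices is a 4-chain and has six edges. A triangle is a 3-chain, and a 4-cycle
without diagonals has the union of its two lower sets strictly between a lower and an upper set;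
both account for five edges. Everything else is a star, a double star, or a triangle with further
vertices hanging off one corner, and there an antichain, or an antichain with its common
neighbour, has enough weight.

For the lower bound, the given family splits into pairwise incomparable diamonds according to the
trace on the first `n - 2` elements.
-/

/-! ### Graphs without a path on five vertices -/

/-- The graph `G` has no (not necessarily induced) path on five vertices. -/
def FiveVertexPathFree {V : Type*} (G : SimpleGraph V) : Prop :=
  ∀ a b c d e, G.Adj a b → G.Adj b c → G.Adj c d → G.Adj d e →
    a ≠ c → a ≠ d → a ≠ e → b ≠ d → b ≠ e → c ≠ e → False

theorem mem_of_adj_closed {V : Type*} {G : SimpleGraph V} {T : Set V} {u v : V} (hu : u ∈ T)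
    (hT : ∀ x ∈ T, ∀ y, G.Adj x y → y ∈ T) (h : G.Reachable u v) : v ∈ T := by
  obtain ⟨p⟩ := h
  induction p with
  | nil => exact hu
  | cons hadj _ ih => exact ih (hT _ hu _ hadj)

/-- The second bound applies with `a = b` as well, so it also covers a triangle. -/
theorem card_edges_le_of_four {V : Type*} {G : SimpleGraph V} {E : Finset (Sym2 V)}
    {a b c d : V}
    (hE : ∀ x y, s(x, y) ∈ E → G.Adj x y ∧ (x = a ∨ x = b ∨ x = c ∨ x = d)) :
    E.card ≤ 6 ∧ (¬ G.Adj a b → E.card ≤ 5) := by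
  classical
  have hsub : ∀ x y, s(x, y) ∈ E →
      G.Adj x y ∧ s(x, y) ∈ ({s(a, b), s(a, c), s(a, d), s(b, c), s(b, d), s(c, d)} :
        Finset (Sym2 V)) := by
    intro x y h
    have hx := hE x y h
    have hy := hE y x (by rwa [Sym2.eq_swap])
    refine ⟨hx.1, ?_⟩
    have := hx.1.ne
    simp only [Finset.mem_insert, Finset.mem_singleton, Sym2.eq_iff]
    rcases hx.2 with rfl | rfl | rfl | rfl <;> rcases hy.2 with rfl | rfl | rfl | rfl <;> simp_all
  constructor
  · refine (Finset.card_le_card fun e he => ?_).trans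
      (Finset.card_le_six (a := s(a, b)) (b := s(a, c)) (c := s(a, d)) (d := s(b, c))
        (e := s(b, d)) (f := s(c, d)))
    induction e with | _ x y => exact (hsub x y he).2
  · intro hab
    refine (Finset.card_le_card fun e he => ?_).trans
      (Finset.card_le_five (a := s(a, c)) (b := s(a, d)) (c := s(b, c)) (d := s(b, d))
        (e := s(c, d)))
    induction e with | _ x y => ?_
    obtain ⟨hxy, hmem⟩ := hsub x y he
    refine (Finset.mem_insert.1 hmem).resolve_left fun h => hab ?_
    rwa [← SimpleGraph.mem_edgeSet, ← h]

section Structure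

variable {V : Type*} [Fintype V] {G : SimpleGraph V} {u : V}
  {E : Finset (Sym2 V)}

open Classical in
/-- The case in which a triangle has two further neighbours hanging off the same corner: then every
edge contains that corner or is the opposite side of the triangle. -/
theorem component_of_triangle_of_two_pendants (hG : FiveVertexPathFree G)
    (hE : ∀ a b, s(a, b) ∈ E → G.Adj a b ∧ G.Reachable u a)
    {v w z₁ z₂ : V} (huv : G.Adj u v) (huw : G.Adj u w) (hvw : G.Adj v w)
    (hz : z₁ ≠ z₂) (h₁ : G.Adj u z₁) (h₂ : G.Adj u z₂)
    (h₁v : z₁ ≠ v) (h₁w : z₁ ≠ w) (h₂v : z₂ ≠ v) (h₂w : z₂ ≠ w) :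
    E.card ≤ 5 ∨
    (∃ S : Finset V, (∀ x ∈ S, G.Adj u x) ∧ (∀ x ∈ S, ∀ y ∈ S, ¬ G.Adj x y) ∧
      (4 * E.card ≤ 5 * S.card ∨ 2 ≤ S.card ∧ S.card ≤ 7 ∧ 4 * E.card ≤ 5 * S.card + 4)) := by
  have hv : ∀ x, G.Adj v x → x = u ∨ x = w := by
    intro x hx
    by_contra! hcon
    by_cases hxz : x = z₁
    · exact hG x v w u z₂ hx.symm hvw huw.symm h₂ hcon.2 hcon.1 (by grind) huv.ne' h₂v.symm
        h₂w.symm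
    · exact hG x v w u z₁ hx.symm hvw huw.symm h₁ hcon.2 hcon.1 hxz huv.ne' h₁v.symm
        h₁w.symm
  have hw : ∀ x, G.Adj w x → x = u ∨ x = v := by
    intro x hx
    by_contra! hcon
    by_cases hxz : x = z₁
    · exact hG x w v u z₂ hx.symm hvw.symm huv.symm h₂ hcon.2 hcon.1 (by grind) huw.ne' h₂w.symm
        h₂v.symm
    · exact hG x w v u z₁ hx.symm hvw.symm huv.symm h₁ hcon.2 hcon.1 hxz huw.ne' h₁w.symm
        h₁v.symm
  have hpend : ∀ y, G.Adj u y → y ≠ v → y ≠ w → ∀ x, G.Adj y x → x = u := by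
    intro y hy hyv hyw x hx
    by_contra hxu
    by_cases hxv : x = v
    · subst hxv; have := hv y hx.symm; have := hy.ne'; grind
    by_cases hxw : x = w
    · subst hxw; have := hw y hx.symm; have := hy.ne'; grind
    exact hG x y u v w hx.symm hy.symm huv hvw hxu hxv hxw hyv hyw huw.ne
  have hcomp : ∀ x, G.Reachable u x → x = u ∨ G.Adj u x := by
    intro x hx
    refine mem_of_adj_closed (T := {x | x = u ∨ G.Adj u x}) (Or.inl rfl) ?_ hx
    rintro x (rfl | hx) y hy
    · exact Or.inr hy
    · by_cases hxv : x = v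
      · subst hxv; rcases hv y hy with rfl | rfl
        · exact Or.inl rfl
        · exact Or.inr huw
      by_cases hxw : x = w
      · subst hxw; rcases hw y hy with rfl | rfl
        · exact Or.inl rfl
        · exact Or.inr huv
      exact Or.inl (hpend x hx hxv hxw y hy)
  set N : Finset V := Finset.univ.filter fun x => G.Adj u x with hN
  have hEsub : E ⊆ insert s(v, w) (N.image fun x => s(u, x)) := by
    intro e he
    induction e with | _ a b => ?_
    obtain ⟨hab, hua⟩ := hE a b he
    simp only [Finset.mem_insert, Finset.mem_image, hN, Finset.mem_filter, Finset.mem_univ,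
      true_and]
    rcases hcomp a hua with rfl | ha
    · exact Or.inr ⟨b, hab, rfl⟩
    · by_cases hbu : b = u
      · subst hbu; exact Or.inr ⟨a, ha, Sym2.eq_swap⟩
      left
      by_cases hav : a = v
      · subst hav; rcases hv b hab with rfl | rfl
        · exact absurd rfl hbu
        · rfl
      by_cases haw : a = w
      · subst haw; rcases hw b hab with rfl | rfl
        · exact absurd rfl hbu
        · exact Sym2.eq_swap
      exact absurd (hpend a ha hav haw b hab) hbu
  have hEcard : E.card ≤ N.card + 1 :=
    (Finset.card_le_card hEsub).trans ((Finset.card_insert_le _ _).trans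
      (Nat.add_le_add_right Finset.card_image_le 1))
  have hwN : w ∈ N := by simp [hN, huw]
  have hScard : (N.erase w).card + 1 = N.card := Finset.card_erase_add_one hwN
  by_cases h5 : E.card ≤ 5
  · exact Or.inl h5
  refine Or.inr ⟨N.erase w, ?_, ?_, ?_⟩
  · intro x hx; simpa [hN] using (Finset.mem_of_mem_erase hx)
  · intro x hx y hy hxy
    simp only [hN, Finset.mem_erase, Finset.mem_filter, Finset.mem_univ, true_and] at hx hy
    by_cases hxv : x = v
    · subst hxv; rcases hv y hxy with rfl | rfl
      · exact hy.2.ne rfl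
      · exact hy.1 rfl
    · exact hy.2.ne' (hpend x hx.2 hxv hx.1 y hxy)
  · omega

open Classical in
/-- The component of a vertex `u` of maximum degree, when there are no triangles and no
4-cycles: it is a star or a double star. -/
theorem component_of_triangleFree_of_squareFree (hG : FiveVertexPathFree G)
    (hE : ∀ a b, s(a, b) ∈ E → G.Adj a b ∧ G.Reachable u a)
    (hmax : ∀ x, G.Reachable u x → G.degree x ≤ G.degree u)
    (h3 : ∀ x y z, G.Reachable u x → G.Adj x y → G.Adj y z → ¬ G.Adj z x)
    (h4 : ∀ x y z t, G.Reachable u x → G.Adj x y → G.Adj y z → G.Adj z t → G.Adj t x →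
      x ≠ z → y ≠ t → False) :
    ∃ S : Finset V, (∀ x ∈ S, G.Reachable u x) ∧ (∀ x ∈ S, ∀ y ∈ S, ¬ G.Adj x y) ∧
      (4 * E.card ≤ 5 * S.card ∨ (∀ x ∈ S, G.Adj u x) ∧
        2 ≤ S.card ∧ S.card ≤ 7 ∧ 4 * E.card ≤ 5 * S.card + 4) := by
  have hNindep : ∀ v, G.Reachable u v → ∀ x ∈ G.neighborFinset v, ∀ y ∈ G.neighborFinset v,
      ¬ G.Adj x y := by
    intro v huv x hx y hy hxy
    rw [SimpleGraph.mem_neighborFinset] at hx hy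
    exact h3 v x y huv hx hxy hy.symm
  by_cases hstar : ∀ v, G.Adj u v → ∀ z, G.Adj v z → z = u
  · refine ⟨G.neighborFinset u, fun x hx => ?_, hNindep u (SimpleGraph.Reachable.refl u), Or.inl ?_⟩
    · exact ((SimpleGraph.mem_neighborFinset _ _ _).1 hx).reachable
    have hsub : E ⊆ (G.neighborFinset u).image fun x => s(u, x) := by
      intro e he
      induction e with | _ a b => ?_
      obtain ⟨hab, hua⟩ := hE a b he
      have : a = u ∨ G.Adj u a := by
        refine mem_of_adj_closed (T := {x | x = u ∨ G.Adj u x}) (Or.inl rfl) ?_ hua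
        rintro x (rfl | hx) y hy
        · exact Or.inr hy
        · exact Or.inl (hstar x hx y hy)
      simp only [Finset.mem_image, SimpleGraph.mem_neighborFinset]
      rcases this with rfl | ha
      · exact ⟨b, hab, rfl⟩
      · obtain rfl := hstar a ha b hab
        exact ⟨a, ha, Sym2.eq_swap⟩
    have := (Finset.card_le_card hsub).trans Finset.card_image_le
    omega
  push Not at hstar
  obtain ⟨v, huv, z, hvz, hzu⟩ := hstar
  have hdv : 2 ≤ G.degree v := by
    rw [← SimpleGraph.card_neighborFinset_eq_degree]
    refine Finset.one_lt_card.2 ⟨u, ?_, z, ?_, hzu.symm⟩ <;> simp [huv.symm, hvz]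
  have hdu : G.degree v ≤ G.degree u := hmax v huv.reachable
  obtain ⟨v', hv', hvv'⟩ : ∃ v', G.Adj u v' ∧ v' ≠ v := by
    have : 1 < (G.neighborFinset u).card := by
      rw [SimpleGraph.card_neighborFinset_eq_degree]; omega
    obtain ⟨v', h, h'⟩ := Finset.exists_mem_ne this v
    exact ⟨v', by simpa using h, h'⟩
  have hu' : ∀ y, G.Adj u y → y ≠ v → ∀ x, G.Adj y x → x = u := by
    intro y hy hyv x hx
    by_contra hxu
    have hxv : x ≠ v := by
      rintro rfl; exact h3 u y x (SimpleGraph.Reachable.refl u) hy hx huv.symm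
    by_cases hzx : z = x
    · subst hzx
      exact h4 u v z y (SimpleGraph.Reachable.refl u) huv hvz hx.symm hy.symm hzu.symm hyv.symm
    · have hzy : z ≠ y := by
        rintro rfl; exact h3 u v z (SimpleGraph.Reachable.refl u) huv hvz hy.symm
      exact hG z v u y x hvz.symm huv.symm hy hx hzu hzy hzx hyv.symm hxv.symm (Ne.symm hxu)
  have hv'' : ∀ y, G.Adj v y → y ≠ u → ∀ x, G.Adj y x → x = v := by
    intro y hy hyu x hx
    by_contra hxv
    have hxu : x ≠ u := by
      rintro rfl; exact h3 x v y (SimpleGraph.Reachable.refl x) huv hy hx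
    have hyv' : y ≠ v' := by
      rintro rfl; exact h3 u v y (SimpleGraph.Reachable.refl u) huv hy hv'.symm
    by_cases hxv' : x = v'
    · subst hxv'
      exact h4 u v y x (SimpleGraph.Reachable.refl u) huv hy hx hv'.symm hyu.symm hvv'.symm
    · exact hG x y v u v' hx.symm hy.symm huv.symm hv' hxv hxu hxv' hyu hyv' hvv'.symm
  have hcomp : ∀ x, G.Reachable u x → G.Adj u x ∨ G.Adj v x := by
    intro x hx
    refine mem_of_adj_closed (T := {x | G.Adj u x ∨ G.Adj v x}) (Or.inr huv.symm) ?_ hx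
    rintro x (hx | hx) y hy
    · by_cases hxv : x = v
      · subst hxv; exact Or.inr hy
      · obtain rfl := hu' x hx hxv y hy; exact Or.inr huv.symm
    · by_cases hxu : x = u
      · subst hxu; exact Or.inl hy
      · obtain rfl := hv'' x hx hxu y hy; exact Or.inl huv
  have hsub : E ⊆ ((G.neighborFinset u).image fun x => s(u, x)) ∪
      (((G.neighborFinset v).erase u).image fun x => s(v, x)) := by
    intro e he
    induction e with | _ a b => ?_
    obtain ⟨hab, hua⟩ := hE a b he
    simp only [Finset.mem_union, Finset.mem_image, SimpleGraph.mem_neighborFinset,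
      Finset.mem_erase]
    by_cases hau : a = u
    · subst hau; exact Or.inl ⟨b, hab, rfl⟩
    by_cases hbu : b = u
    · subst hbu; exact Or.inl ⟨a, hab.symm, Sym2.eq_swap⟩
    by_cases hav : a = v
    · subst hav; exact Or.inr ⟨b, ⟨hbu, hab⟩, rfl⟩
    rcases hcomp a hua with h | h
    · exact absurd (hu' a h hav b hab) hbu
    · obtain rfl := hv'' a h hau b hab
      exact Or.inr ⟨a, ⟨hau, hab.symm⟩, Sym2.eq_swap⟩
  have huN : u ∈ G.neighborFinset v := by simpa using huv.symm
  have hvN : v ∈ G.neighborFinset u := by simpa using huv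
  have hc1 := Finset.card_erase_add_one huN
  have hc2 := Finset.card_erase_add_one hvN
  rw [SimpleGraph.card_neighborFinset_eq_degree] at hc1 hc2
  have hEcard : E.card ≤ G.degree u + ((G.neighborFinset v).erase u).card := by
    refine (Finset.card_le_card hsub).trans ((Finset.card_union_le _ _).trans ?_)
    rw [← SimpleGraph.card_neighborFinset_eq_degree G u]
    exact Nat.add_le_add Finset.card_image_le Finset.card_image_le
  by_cases hsmall : 5 ≤ G.degree u + ((G.neighborFinset v).erase u).card
  · refine ⟨(G.neighborFinset u).erase v ∪ (G.neighborFinset v).erase u, ?_, ?_, Or.inl ?_⟩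
    · intro x hx
      simp only [Finset.mem_union, Finset.mem_erase, SimpleGraph.mem_neighborFinset] at hx
      rcases hx with hx | hx
      · exact hx.2.reachable
      · exact huv.reachable.trans hx.2.reachable
    · intro x hx y hy hxy
      simp only [Finset.mem_union, Finset.mem_erase, SimpleGraph.mem_neighborFinset] at hx hy
      rcases hx with hx | hx
      · obtain rfl := hu' x hx.2 hx.1 y hxy
        rcases hy with hy | hy
        · exact hy.2.ne rfl
        · exact hy.1 rfl
      · obtain rfl := hv'' x hx.2 hx.1 y hxy
        rcases hy with hy | hy
        · exact hy.1 rfl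
        · exact hy.2.ne rfl
    · rw [Finset.card_union_of_disjoint]
      · omega
      · rw [Finset.disjoint_left]
        intro x hx hx'
        simp only [Finset.mem_erase, SimpleGraph.mem_neighborFinset] at hx hx'
        exact h3 u v x (SimpleGraph.Reachable.refl u) huv hx'.2 hx.2.symm
  · refine ⟨G.neighborFinset u, fun x hx => ?_, hNindep u (SimpleGraph.Reachable.refl u),
      Or.inr ⟨fun x hx => (SimpleGraph.mem_neighborFinset _ _ _).1 hx, ?_⟩⟩
    · exact ((SimpleGraph.mem_neighborFinset _ _ _).1 hx).reachable
    · rw [SimpleGraph.card_neighborFinset_eq_degree]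
      omega

/-- A connected graph without a path on five vertices is small, or it is a star, a double star, or
a triangle with further vertices hanging off one corner. Each alternative pairs a substructure of
the component of `u` with a bound on its number of edges; the constants are those that the weight
estimates for the substructures can afford. -/
theorem component_structure (hG : FiveVertexPathFree G)
    (hE : ∀ a b, s(a, b) ∈ E → G.Adj a b ∧ G.Reachable u a) :
    (∃ a b c d, G.Reachable u a ∧ G.Adj a b ∧ G.Adj a c ∧ G.Adj a d ∧ G.Adj b c ∧ G.Adj b d ∧
      G.Adj c d ∧ E.card ≤ 6) ∨
    (∃ a b c, G.Reachable u a ∧ G.Adj a b ∧ G.Adj b c ∧ G.Adj c a ∧ E.card ≤ 5) ∨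
    (∃ a b c d, G.Reachable u a ∧ G.Adj a b ∧ G.Adj b c ∧ G.Adj c d ∧ G.Adj d a ∧
      a ≠ c ∧ b ≠ d ∧ ¬ G.Adj a c ∧ ¬ G.Adj b d ∧ E.card ≤ 5) ∨
    (∃ S : Finset V, (∀ x ∈ S, G.Reachable u x) ∧ (∀ x ∈ S, ∀ y ∈ S, ¬ G.Adj x y) ∧
      4 * E.card ≤ 5 * S.card) ∨
    (∃ v, ∃ S : Finset V, G.Reachable u v ∧ (∀ x ∈ S, G.Adj v x) ∧
      (∀ x ∈ S, ∀ y ∈ S, ¬ G.Adj x y) ∧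
      2 ≤ S.card ∧ S.card ≤ 7 ∧ 4 * E.card ≤ 5 * S.card + 4) := by
  classical
  have hmove : ∀ {v}, G.Reachable u v → ∀ a b, s(a, b) ∈ E → G.Adj a b ∧ G.Reachable v a :=
    fun hv a b h => ⟨(hE a b h).1, hv.symm.trans (hE a b h).2⟩
  by_cases hK4 : ∃ a b c d, G.Reachable u a ∧ G.Adj a b ∧ G.Adj a c ∧ G.Adj a d ∧ G.Adj b c ∧
      G.Adj b d ∧ G.Adj c d
  · obtain ⟨a, b, c, d, hua, hab, hac, had, hbc, hbd, hcd⟩ := hK4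
    refine Or.inl ⟨a, b, c, d, hua, hab, hac, had, hbc, hbd, hcd, ?_⟩
    refine (card_edges_le_of_four (G := G) (a := a) (b := b) (c := c) (d := d)
      fun x y h => ⟨(hE x y h).1, ?_⟩).1
    refine mem_of_adj_closed (T := {x | x = a ∨ x = b ∨ x = c ∨ x = d}) (Or.inl rfl) ?_
      (hmove hua x y h).2
    intro x hx y hy
    by_contra! hcon
    simp only [Set.mem_ofPred_eq, not_or] at hcon hx
    obtain ⟨h1, h2, h3, h4⟩ := hcon
    rcases hx with rfl | rfl | rfl | rfl
    · exact hG y x b c d hy.symm hab hbc hcd h2 h3 h4 hac.ne had.ne hbd.ne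
    · exact hG y x a c d hy.symm hab.symm hac hcd h1 h3 h4 hbc.ne hbd.ne had.ne
    · exact hG y x a b d hy.symm hac.symm hab hbd h1 h2 h4 hbc.ne' hcd.ne had.ne
    · exact hG y x a b c hy.symm had.symm hab hbc h1 h2 h3 hbd.ne' hcd.ne' hac.ne
  by_cases h3 : ∃ a b c, G.Reachable u a ∧ G.Adj a b ∧ G.Adj b c ∧ G.Adj c a
  · by_cases hp : ∃ a b c z₁ z₂, G.Reachable u a ∧ G.Adj a b ∧ G.Adj a c ∧ G.Adj b c ∧
      z₁ ≠ z₂ ∧ G.Adj a z₁ ∧ G.Adj a z₂ ∧ z₁ ≠ b ∧ z₁ ≠ c ∧ z₂ ≠ b ∧ z₂ ≠ c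
    · obtain ⟨a, b, c, z₁, z₂, hua, hab, hac, hbc, hz, h1, h2, h1b, h1c, h2b, h2c⟩ := hp
      rcases component_of_triangle_of_two_pendants hG (hmove hua) hab hac hbc hz h1 h2 h1b h1c h2b
        h2c with h | ⟨S, hS, hS', h | ⟨h2, h7, h⟩⟩
      · exact Or.inr (Or.inl ⟨a, b, c, hua, hab, hbc, hac.symm, h⟩)
      · exact Or.inr (Or.inr (Or.inr (Or.inl ⟨S, fun x hx => hua.trans (hS x hx).reachable,
          hS', h⟩)))
      · exact Or.inr (Or.inr (Or.inr (Or.inr ⟨a, S, hua, hS, hS', h2, h7, h⟩)))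
    · obtain ⟨a, b, c, hua, hab, hbc, hca⟩ := h3
      refine Or.inr (Or.inl ⟨a, b, c, hua, hab, hbc, hca, ?_⟩)
      -- At most one vertex outside the triangle is adjacent to it.
      have hone : ∀ a b c, G.Reachable u a → G.Adj a b → G.Adj b c → G.Adj c a →
          ∀ z, z ≠ b → z ≠ c → G.Adj a z → E.card ≤ 5 := by
        intro a b c hua hab hbc hca z hzb hzc hz
        have hz' : ∀ y, G.Adj a y → y = b ∨ y = c ∨ y = z := by
          intro y hy
          by_contra! hcon
          exact hp ⟨a, b, c, z, y, hua, hab, hca.symm, hbc, hcon.2.2.symm, hz, hy, hzb, hzc,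
            hcon.1, hcon.2.1⟩
        have hcl : ∀ x, G.Reachable a x → x = z ∨ x = a ∨ x = b ∨ x = c := by
          intro x hx
          refine mem_of_adj_closed (T := {x | x = z ∨ x = a ∨ x = b ∨ x = c}) (by simp) ?_ hx
          intro x hx y hy
          by_contra! hcon
          simp only [Set.mem_ofPred_eq, not_or] at hcon hx
          obtain ⟨h1, h2, h3, h4⟩ := hcon
          rcases hx with rfl | rfl | rfl | rfl
          · exact hG y x a b c hy.symm hz.symm hab hbc h2 h3 h4 hzb hzc hca.ne'
          · rcases hz' y hy with h | h | h <;> contradiction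
          · exact hG y x c a z hy.symm hbc hca hz h4 h2 h1 hab.ne' hzb.symm hzc.symm
          · exact hG y x b a z hy.symm hbc.symm hab.symm hz h3 h2 h1 hca.ne hzc.symm hzb.symm
        by_cases hzb' : G.Adj z b
        · by_cases hzc' : G.Adj z c
          · exact absurd ⟨a, b, c, z, hua, hab, hca.symm, hz, hbc, hzb'.symm, hzc'.symm⟩ hK4
          · refine (card_edges_le_of_four (G := G) (a := z) (b := c) (c := a) (d := b)
              fun x y h => ⟨(hE x y h).1, ?_⟩).2 hzc'
            have := hcl x (hmove hua x y h).2
            tauto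
        · refine (card_edges_le_of_four (G := G) (a := z) (b := b) (c := a) (d := c)
              fun x y h => ⟨(hE x y h).1, ?_⟩).2 hzb'
          have := hcl x (hmove hua x y h).2
          tauto
      by_cases ha : ∃ z, z ≠ b ∧ z ≠ c ∧ G.Adj a z
      · obtain ⟨z, h1, h2, h3⟩ := ha
        exact hone a b c hua hab hbc hca z h1 h2 h3
      by_cases hb : ∃ z, z ≠ c ∧ z ≠ a ∧ G.Adj b z
      · obtain ⟨z, h1, h2, h3⟩ := hb
        exact hone b c a (hua.trans hab.reachable) hbc hca hab z h1 h2 h3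
      by_cases hc : ∃ z, z ≠ a ∧ z ≠ b ∧ G.Adj c z
      · obtain ⟨z, h1, h2, h3⟩ := hc
        exact hone c a b (hua.trans hca.symm.reachable) hca hab hbc z h1 h2 h3
      push Not at ha hb hc
      refine (card_edges_le_of_four (G := G) (a := a) (b := a) (c := b) (d := c)
        fun x y h => ⟨(hE x y h).1, ?_⟩).2 (G.loopless.irrefl a)
      have : x = a ∨ x = b ∨ x = c := by
        refine mem_of_adj_closed (T := {x | x = a ∨ x = b ∨ x = c}) (by simp) ?_
          (hmove hua x y h).2
        intro x hx y hy
        by_contra! hcon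
        simp only [Set.mem_ofPred_eq, not_or] at hcon hx
        obtain ⟨h1, h2, h3⟩ := hcon
        rcases hx with rfl | rfl | rfl
        · exact ha y h2 h3 hy
        · exact hb y h3 h1 hy
        · exact hc y h1 h2 hy
      tauto
  have h3' : ∀ a b c, G.Reachable u a → G.Adj a b → G.Adj b c → ¬ G.Adj c a :=
    fun a b c h h1 h2 h' => h3 ⟨a, b, c, h, h1, h2, h'⟩
  by_cases h4 : ∃ a b c d, G.Reachable u a ∧ G.Adj a b ∧ G.Adj b c ∧ G.Adj c d ∧ G.Adj d a ∧
      a ≠ c ∧ b ≠ d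
  · obtain ⟨a, b, c, d, hua, hab, hbc, hcd, hda, hac, hbd⟩ := h4
    have hac' : ¬ G.Adj a c := fun h => h3' a b c hua hab hbc h.symm
    have hbd' : ¬ G.Adj b d := fun h => h3' b c d (hua.trans hab.reachable) hbc hcd h.symm
    refine Or.inr (Or.inr (Or.inl ⟨a, b, c, d, hua, hab, hbc, hcd, hda, hac, hbd, hac', hbd', ?_⟩))
    refine (card_edges_le_of_four (G := G) (a := a) (b := c) (c := b) (d := d)
      fun x y h => ⟨(hE x y h).1, ?_⟩).2 hac'
    refine mem_of_adj_closed (T := {x | x = a ∨ x = c ∨ x = b ∨ x = d}) (Or.inl rfl) ?_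
      (hmove hua x y h).2
    intro x hx y hy
    by_contra! hcon
    simp only [Set.mem_ofPred_eq, not_or] at hcon hx
    obtain ⟨h1, h2, h3, h4⟩ := hcon
    rcases hx with rfl | rfl | rfl | rfl
    · exact hG y x b c d hy.symm hab hbc hcd h3 h2 h4 hac hda.ne' hbd
    · exact hG y x d a b hy.symm hcd hda hab h4 h1 h3 hac.symm hbc.ne' hbd.symm
    · exact hG y x c d a hy.symm hbc hcd hda h2 h4 h1 hbd hab.ne' hac.symm
    · exact hG y x a b c hy.symm hda hab hbc h1 h3 h2 hbd.symm hcd.ne' hac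
  obtain ⟨v, hv, hvmax⟩ := Finset.exists_max_image
    (Finset.univ.filter fun x => G.Reachable u x) (fun x => G.degree x) ⟨u, by simp⟩
  simp only [Finset.mem_filter, Finset.mem_univ, true_and] at hv hvmax
  obtain ⟨S, hS, hS', h | h⟩ := component_of_triangleFree_of_squareFree hG (hmove hv)
    (fun x hx => hvmax x (hv.trans hx)) (fun a b c h => h3' a b c (hv.trans h))
    (fun a b c d h h1 h2 h3 h4' h5 h6 => h4 ⟨a, b, c, d, hv.trans h, h1, h2, h3, h4', h5, h6⟩)
  · exact Or.inr (Or.inr (Or.inr (Or.inl ⟨S, fun x hx => hv.trans (hS x hx), hS', h⟩)))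
  · exact Or.inr (Or.inr (Or.inr (Or.inr ⟨v, S, hv, h.1, hS', h.2⟩)))

end Structure

/-! ### Counting maximal chains as permutations -/

section Precedence

variable {n : ℕ}

/-- The permutations of `Fin n`, read as linear orders in which `x` has position `σ x`, that place
every element of `A` before every element of `D`. A permutation corresponds to the maximal chain of
its initial segments: for `A ⊆ B`, the chain meets the interval `[A, B]` if and only if the
permutation lies in `precedes A Bᶜ`; it passes through `A` if and only if it lies in
`precedes A Aᶜ`. -/
def precedes (A D : Finset (Fin n)) : Finset (Equiv.Perm (Fin n)) :=
  Finset.univ.filter fun σ => ∀ x ∈ A, ∀ y ∈ D, σ x < σ y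

theorem mem_precedes {A D : Finset (Fin n)} {σ : Equiv.Perm (Fin n)} :
    σ ∈ precedes A D ↔ ∀ x ∈ A, ∀ y ∈ D, σ x < σ y := by
  simp [precedes]

/-- Chains meeting the intervals `[A, B]` and `[A', B']` force a comparability between them. -/
theorem subset_or_subset_of_mem_precedes {A B A' B' : Finset (Fin n)} {σ : Equiv.Perm (Fin n)}
    (h : σ ∈ precedes A Bᶜ) (h' : σ ∈ precedes A' B'ᶜ) : A ⊆ B' ∨ A' ⊆ B := by
  rw [mem_precedes] at h h'
  by_contra! hcon
  obtain ⟨x, hx, hxB⟩ := Finset.not_subset.1 hcon.1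
  obtain ⟨y, hy, hyB⟩ := Finset.not_subset.1 hcon.2
  exact lt_asymm (h x hx y (by simpa using hyB)) (h' y hy x (by simpa using hxB))

theorem disjoint_precedes_of_not_subset {A B : Finset (Fin n)} (h : ¬ A ⊆ B) (h' : ¬ B ⊆ A) :
    Disjoint (precedes A Aᶜ) (precedes B Bᶜ) := by
  rw [Finset.disjoint_left]
  intro σ hA hB
  rcases subset_or_subset_of_mem_precedes hA hB with h1 | h1
  exacts [h h1, h' h1]

/-- Any two ordered pairs of disjoint sets with matching cardinalities are related by a permutation
of the ground set. -/
theorem exists_perm_mem_iff {A D A' D' : Finset (Fin n)} (hAD : Disjoint A D)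
    (hAD' : Disjoint A' D') (hA : A.card = A'.card) (hD : D.card = D'.card) :
    ∃ g : Equiv.Perm (Fin n), (∀ x, g x ∈ A' ↔ x ∈ A) ∧ ∀ x, g x ∈ D' ↔ x ∈ D := by
  classical
  -- Colour the elements by membership in the first set, the second set, or neither.
  let f : Finset (Fin n) → Finset (Fin n) → Fin n → Fin 3 :=
    fun A D x => if x ∈ A then 0 else if x ∈ D then 1 else 2
  have hf0 : ∀ (A D : Finset (Fin n)) x, f A D x = 0 ↔ x ∈ A := by
    intro A D x; simp only [f]; split_ifs <;> simp_all
  have hf1 : ∀ (A D : Finset (Fin n)), Disjoint A D → ∀ x, f A D x = 1 ↔ x ∈ D := by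
    intro A D h x
    have : x ∈ A → x ∉ D := fun hx => Finset.disjoint_left.1 h hx
    simp only [f]; split_ifs <;> simp_all
  have hf2 : ∀ (A D : Finset (Fin n)) x, f A D x = 2 ↔ x ∈ (A ∪ D)ᶜ := by
    intro A D x; simp only [f]; split_ifs <;> simp_all
  have hcard : ∀ c : Fin 3, Fintype.card {x // f A D x = c} =
      Fintype.card {x // f A' D' x = c} := by
    intro c
    rw [Fintype.card_subtype, Fintype.card_subtype]
    fin_cases c
    · simpa [hf0] using hA
    · simpa [hf1 _ _ hAD, hf1 _ _ hAD'] using hD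
    · have h : ∀ (A D : Finset (Fin n)), (Finset.univ.filter fun x => f A D x = 2) = (A ∪ D)ᶜ := by
        intro A D; ext x; simp [hf2]
      show (Finset.univ.filter fun x => f A D x = 2).card =
        (Finset.univ.filter fun x => f A' D' x = 2).card
      rw [h, h, Finset.card_compl, Finset.card_compl, Finset.card_union_of_disjoint hAD,
        Finset.card_union_of_disjoint hAD', hA, hD]
  let g := Equiv.ofFiberEquiv fun c => Fintype.equivOfCardEq (hcard c)
  have hg : ∀ x, f A' D' (g x) = f A D x := fun x => Equiv.ofFiberEquiv_map _ x
  exact ⟨g, fun x => by rw [← hf0 A' D', hg, hf0],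
    fun x => by rw [← hf1 A' D' hAD', hg, hf1 A D hAD]⟩

theorem card_precedes_eq {A D A' D' : Finset (Fin n)} (hAD : Disjoint A D)
    (hAD' : Disjoint A' D') (hA : A.card = A'.card) (hD : D.card = D'.card) :
    (precedes A D).card = (precedes A' D').card := by
  obtain ⟨g, hgA, hgD⟩ := exists_perm_mem_iff hAD' hAD hA.symm hD.symm
  refine Finset.card_bij' (fun σ _ => g.trans σ) (fun σ _ => g.symm.trans σ) ?_ ?_ ?_ ?_
  · intro σ hσ
    rw [mem_precedes] at hσ ⊢
    exact fun x hx y hy => hσ _ ((hgA x).2 hx) _ ((hgD y).2 hy)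
  · intro σ hσ
    rw [mem_precedes] at hσ ⊢
    intro x hx y hy
    exact hσ _ ((hgA _).1 (by simpa using hx)) _ ((hgD _).1 (by simpa using hy))
  · intro σ _; ext x; simp
  · intro σ _; ext x; simp

theorem exists_initial_subset (σ : Equiv.Perm (Fin n)) (W : Finset (Fin n)) (k : ℕ)
    (hk : k ≤ W.card) : ∃ A ⊆ W, A.card = k ∧ σ ∈ precedes A (W \ A) := by
  induction k with
  | zero => exact ⟨∅, by simp, by simp, by simp [mem_precedes]⟩
  | succ k ih =>
    obtain ⟨A, hAW, hA, hσ⟩ := ih (by omega)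
    rw [mem_precedes] at hσ
    have hne : (W \ A).Nonempty := by
      rw [← Finset.card_pos, Finset.card_sdiff_of_subset hAW]; omega
    obtain ⟨x, hx, hmin⟩ := Finset.exists_min_image (W \ A) σ hne
    rw [Finset.mem_sdiff] at hx
    refine ⟨insert x A, Finset.insert_subset hx.1 hAW, by
      rw [Finset.card_insert_of_notMem hx.2, hA], ?_⟩
    rw [mem_precedes]
    intro a ha y hy
    simp only [Finset.mem_sdiff, Finset.mem_insert, not_or] at hy
    rcases Finset.mem_insert.1 ha with rfl | ha
    · exact lt_of_le_of_ne (hmin y (by simp [hy])) fun h => hy.2.1 (σ.injective h).symm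
    · exact hσ a ha y (by simp [hy])

/-- The proportion of permutations in which `A` precedes `D` is at least (in fact exactly) the
reciprocal of a binomial coefficient: every permutation picks the initial segment of size `#A` of
`A ∪ D`, and all candidates are equally frequent. -/
theorem factorial_le_choose_mul_card_precedes {A D : Finset (Fin n)} (h : Disjoint A D) :
    n.factorial ≤ (A.card + D.card).choose A.card * (precedes A D).card := by
  classical
  have hcover : (Finset.univ : Finset (Equiv.Perm (Fin n))) ⊆
      ((A ∪ D).powersetCard A.card).biUnion fun A' => precedes A' ((A ∪ D) \ A') := by
    intro σ _
    obtain ⟨A', h1, h2, h3⟩ := exists_initial_subset σ (A ∪ D) A.card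
      (Finset.card_le_card Finset.subset_union_left)
    exact Finset.mem_biUnion.2 ⟨A', Finset.mem_powersetCard.2 ⟨h1, h2⟩, h3⟩
  have hle := (Finset.card_le_card hcover).trans
    (Finset.card_biUnion_le_card_mul _ _ (precedes A D).card ?_)
  · rwa [Finset.card_univ, Fintype.card_perm, Fintype.card_fin, Finset.card_powersetCard,
      Finset.card_union_of_disjoint h] at hle
  · intro A' hA'
    rw [Finset.mem_powersetCard] at hA'
    refine (card_precedes_eq Finset.disjoint_sdiff h hA'.2 ?_).le
    rw [Finset.card_sdiff_of_subset hA'.1, hA'.2, Finset.card_union_of_disjoint h]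
    omega

theorem self_le_choose {m k : ℕ} (h1 : 1 ≤ k) (h2 : k < m) : m ≤ m.choose k := by
  induction m generalizing k with
  | zero => omega
  | succ m ih =>
    obtain ⟨k, rfl⟩ : ∃ j, k = j + 1 := ⟨k - 1, by omega⟩
    rw [Nat.choose_succ_succ']
    rcases Nat.lt_or_ge (k + 1) m with h | h
    · have := ih (by omega) h
      have := Nat.choose_pos (n := m) (k := k) (by omega)
      omega
    · obtain rfl : m = k + 1 := by omega
      simp

/-- Few of the maximal chains through `X` pass through a given proper superset `Y ≠ univ`. -/
theorem card_precedes_inter_le {X Y : Finset (Fin n)} (hXY : X ⊂ Y) (hY : Y ≠ Finset.univ) :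
    (n - X.card) * (precedes X Xᶜ ∩ precedes Y Yᶜ).card ≤ (precedes X Xᶜ).card := by
  classical
  set k := (Y \ X).card with hk
  have hkY : k + X.card = Y.card := by
    rw [hk, Finset.card_sdiff_of_subset hXY.1, Nat.sub_add_cancel (Finset.card_le_card hXY.1)]
  have hXY' := Finset.card_lt_card hXY
  have hYn : Y.card < n := by
    simpa using Finset.card_lt_card (Finset.ssubset_univ_iff.2 hY)
  have hch : n - X.card ≤ (Xᶜ.powersetCard k).card := by
    rw [Finset.card_powersetCard, Finset.card_compl, Fintype.card_fin]
    exact self_le_choose (by omega) (by omega)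
  have hsame : ∀ S ∈ Xᶜ.powersetCard k, (precedes X Xᶜ ∩ precedes (X ∪ S) (X ∪ S)ᶜ).card =
      (precedes X Xᶜ ∩ precedes Y Yᶜ).card := by
    intro S hS
    rw [Finset.mem_powersetCard] at hS
    have hXS : Disjoint X S := by
      rw [Finset.disjoint_left]; intro x hx hxS; exact (Finset.mem_compl.1 (hS.1 hxS)) hx
    obtain ⟨g, hgX, hgS⟩ := exists_perm_mem_iff (A := X) (D := Y \ X) (A' := X) (D' := S)
      Finset.disjoint_sdiff hXS rfl hS.2.symm
    have hgY : ∀ x, g x ∈ X ∪ S ↔ x ∈ Y := by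
      intro x
      rw [Finset.mem_union, hgX, hgS, Finset.mem_sdiff]
      have := @hXY.1 x
      tauto
    refine Finset.card_bij' (fun σ _ => g.trans σ) (fun σ _ => g.symm.trans σ) ?_ ?_ ?_ ?_
    · intro σ hσ
      rw [Finset.mem_inter, mem_precedes, mem_precedes] at hσ ⊢
      simp only [Finset.mem_compl] at hσ ⊢
      exact ⟨fun x hx y hy => hσ.1 _ ((hgX x).2 hx) _ (fun h => hy ((hgX y).1 h)),
        fun x hx y hy => hσ.2 _ ((hgY x).2 hx) _ (fun h => hy ((hgY y).1 h))⟩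
    · intro σ hσ
      rw [Finset.mem_inter, mem_precedes, mem_precedes] at hσ ⊢
      simp only [Finset.mem_compl] at hσ ⊢
      exact ⟨fun x hx y hy => hσ.1 _ ((hgX _).1 (by simpa using hx)) _
          (fun h => hy (by simpa using (hgX _).2 h)),
        fun x hx y hy => hσ.2 _ ((hgY _).1 (by simpa using hx)) _
          (fun h => hy (by simpa using (hgY _).2 h))⟩
    · intro σ _; ext x; simp
    · intro σ _; ext x; simp
  have hdisj : (Xᶜ.powersetCard k : Set (Finset (Fin n))).PairwiseDisjoint
      fun S => precedes X Xᶜ ∩ precedes (X ∪ S) (X ∪ S)ᶜ := by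
    intro S hS T hT hST
    rw [Finset.mem_coe, Finset.mem_powersetCard] at hS hT
    have key : ∀ {S T : Finset (Fin n)}, S ⊆ Xᶜ → S.card = k → T.card = k → S ≠ T →
        ¬ X ∪ S ⊆ X ∪ T := by
      intro S T hS hSk hTk hST hsub
      refine hST (Finset.eq_of_subset_of_card_le (fun x hx => ?_) (by omega))
      have hxX := Finset.mem_compl.1 (hS hx)
      have := hsub (Finset.mem_union_right X hx)
      rw [Finset.mem_union] at this
      tauto
    exact (disjoint_precedes_of_not_subset (key hS.1 hS.2 hT.2 hST)
      (key hT.1 hT.2 hS.2 hST.symm)).mono Finset.inter_subset_right Finset.inter_subset_right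
  calc (n - X.card) * (precedes X Xᶜ ∩ precedes Y Yᶜ).card
      ≤ (Xᶜ.powersetCard k).card * (precedes X Xᶜ ∩ precedes Y Yᶜ).card :=
        Nat.mul_le_mul_right _ hch
    _ = ∑ S ∈ Xᶜ.powersetCard k, (precedes X Xᶜ ∩ precedes (X ∪ S) (X ∪ S)ᶜ).card := by
        rw [Finset.sum_congr rfl hsame, Finset.sum_const, smul_eq_mul]
    _ = ((Xᶜ.powersetCard k).biUnion
          fun S => precedes X Xᶜ ∩ precedes (X ∪ S) (X ∪ S)ᶜ).card :=
        (Finset.card_biUnion hdisj).symm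
    _ ≤ (precedes X Xᶜ).card :=
        Finset.card_le_card (Finset.biUnion_subset.2 fun S _ => Finset.inter_subset_left)

/-- Reversal of the linear orders. -/
theorem card_precedes_inter_swap (A D A' D' : Finset (Fin n)) :
    (precedes A D ∩ precedes A' D').card = (precedes D A ∩ precedes D' A').card := by
  refine Finset.card_bij' (fun σ _ => σ.trans Fin.revPerm) (fun σ _ => σ.trans Fin.revPerm)
    ?_ ?_ ?_ ?_
  · intro σ hσ
    rw [Finset.mem_inter, mem_precedes, mem_precedes] at hσ ⊢
    simp only [Equiv.trans_apply, Fin.revPerm_apply, Fin.rev_lt_rev]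
    exact ⟨fun x hx y hy => hσ.1 y hy x hx, fun x hx y hy => hσ.2 y hy x hx⟩
  · intro σ hσ
    rw [Finset.mem_inter, mem_precedes, mem_precedes] at hσ ⊢
    simp only [Equiv.trans_apply, Fin.revPerm_apply, Fin.rev_lt_rev]
    exact ⟨fun x hx y hy => hσ.1 y hy x hx, fun x hx y hy => hσ.2 y hy x hx⟩
  · intro σ _; ext x; simp
  · intro σ _; ext x; simp

/-- The order dual of `card_precedes_inter_le`. -/
theorem card_precedes_inter_le' {X Y : Finset (Fin n)} (hYX : Y ⊂ X) (hY : Y ≠ ∅) :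
    X.card * (precedes X Xᶜ ∩ precedes Y Yᶜ).card ≤ (precedes X Xᶜ).card := by
  have h := card_precedes_inter_le (X := Xᶜ) (Y := Yᶜ)
    (Finset.compl_ssubset_compl.2 hYX) (by simpa using hY)
  have hX : n - Xᶜ.card = X.card := by
    have := Finset.card_add_card_compl X
    rw [Fintype.card_fin] at this
    omega
  have hself := card_precedes_inter_swap Xᶜ X Xᶜ X
  rw [Finset.inter_self, Finset.inter_self] at hself
  rwa [hX, compl_compl, compl_compl, card_precedes_inter_swap, hself] at h

end Precedence

/-! ### Binomial coefficients and weights of intervals, antichains and claws -/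

section Binomials

theorem choose_le_choose_half_pred {n m : ℕ} (k : ℕ) (hm : m + 2 ≤ n) :
    m.choose k ≤ (n - 2).choose (n / 2 - 1) := by
  have h : n / 2 - 1 = (n - 2) / 2 := by omega
  rw [h]
  exact (Nat.choose_le_choose k (by omega)).trans (Nat.choose_le_middle _ _)

theorem choose_le_four_mul {n : ℕ} (hn : 2 ≤ n) (k : ℕ) :
    n.choose k ≤ 4 * (n - 2).choose (n / 2 - 1) := by
  obtain ⟨m, rfl⟩ : ∃ m, n = m + 2 := ⟨n - 2, by omega⟩
  have key : ∀ j, m.choose j ≤ (m + 2 - 2).choose ((m + 2) / 2 - 1) :=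
    fun j => choose_le_choose_half_pred j le_rfl
  rcases k with _ | _ | k
  · have := key 0
    simp only [Nat.choose_zero_right] at this ⊢
    omega
  · have h0 := key 0
    have h1 := key 1
    simp only [Nat.choose_zero_right, Nat.choose_one_right, zero_add] at h0 h1 ⊢
    omega
  · have h0 := key k
    have h1 := key (k + 1)
    have h2 := key (k + 2)
    have : (m + 2).choose (k + 2) = m.choose k + 2 * m.choose (k + 1) + m.choose (k + 2) := by
      rw [Nat.choose_succ_succ' (m + 1) (k + 1), Nat.choose_succ_succ' m k,
        Nat.choose_succ_succ' m (k + 1)]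
      ring
    change (m + 2).choose (k + 2) ≤ _
    omega

theorem six_mul_choose_le {n m : ℕ} (k : ℕ) (hn : 6 ≤ n) (hm : m + 3 ≤ n) :
    6 * m.choose k ≤ 5 * (n - 2).choose (n / 2 - 1) := by
  set r := (n - 3) / 2 with hr
  have h1 : m.choose k ≤ (n - 3).choose r :=
    (Nat.choose_le_choose k (by omega)).trans (Nat.choose_le_middle _ _)
  have h2 : (n - 3).choose r + (n - 3).choose (r + 1) ≤ (n - 2).choose (n / 2 - 1) := by
    rw [← Nat.choose_succ_succ']
    exact choose_le_choose_half_pred _ (by omega)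
  have h3 := Nat.choose_succ_right_eq (n - 3) r
  have h4 : (n - 3).choose r * (r + 1) ≤ 2 * (n - 3).choose (r + 1) * (r + 1) := by
    rw [mul_assoc, h3, mul_left_comm]
    exact Nat.mul_le_mul_left _ (by omega)
  have h5 := Nat.le_of_mul_le_mul_right h4 (Nat.succ_pos r)
  omega

/-- Far from the middle the binomial coefficients are at most half of the largest one. -/
theorem two_mul_choose_le_of_small {n j : ℕ} (hj : 3 * j + 2 ≤ n) :
    2 * n.choose j ≤ n.choose (n / 2) := by
  have h3 := Nat.choose_succ_right_eq n j
  have h4 : 2 * n.choose j * (j + 1) ≤ n.choose (j + 1) * (j + 1) := by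
    rw [h3, mul_comm 2, mul_assoc]
    exact Nat.mul_le_mul_left _ (by omega)
  exact (Nat.le_of_mul_le_mul_right h4 (Nat.succ_pos j)).trans (Nat.choose_le_middle _ _)

theorem mul_choose_sub_two {n k : ℕ} (hk : 1 ≤ k) (hkn : k < n) :
    n * (n - 1) * (n - 2).choose (k - 1) = n.choose k * (k * (n - k)) := by
  obtain ⟨m, rfl⟩ : ∃ m, n = m + 2 := ⟨n - 2, by omega⟩
  obtain ⟨j, rfl⟩ : ∃ j, k = j + 1 := ⟨k - 1, by omega⟩
  have h1 := Nat.add_one_mul_choose_eq (m + 1) j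
  have h2 := Nat.choose_mul_succ_eq m j
  have h3 : m + 2 - (j + 1) = m + 1 - j := by omega
  simp only [Nat.add_sub_cancel, h3, show m + 2 - 1 = m + 1 from rfl]
  calc (m + 2) * (m + 1) * m.choose j = (m + 2) * (m.choose j * (m + 1)) := by ring
    _ = (m + 1 + 1) * (m + 1).choose j * (m + 1 - j) := by rw [h2]; ring
    _ = _ := by rw [h1]; ring

theorem tendsto_choose_sub_two_div :
    Tendsto (fun n : ℕ => ((n - 2).choose (n / 2 - 1) : ℝ) / (n.choose (n / 2) : ℝ)) atTop
      (𝓝 (1 / 4)) := by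
  have hlim : Tendsto (fun n : ℕ => 1 / ((n : ℝ) - 1)) atTop (𝓝 0) := by
    simp only [one_div]
    exact (tendsto_atTop_add_const_right _ (-1) tendsto_natCast_atTop_atTop).inv_tendsto_atTop
  rw [tendsto_iff_dist_tendsto_zero]
  refine squeeze_zero' (Eventually.of_forall fun _ => dist_nonneg) ?_ hlim
  filter_upwards [eventually_ge_atTop 2] with n hn
  have hC : (0 : ℝ) < n.choose (n / 2) := by exact_mod_cast Nat.choose_pos (Nat.div_le_self n 2)
  have hn' : (2 : ℝ) ≤ n := by exact_mod_cast hn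
  have hid : (n : ℝ) * (n - 1) * (n - 2).choose (n / 2 - 1) =
      n.choose (n / 2) * ((n / 2 : ℕ) * (n - (n / 2 : ℕ))) := by
    have := mul_choose_sub_two (n := n) (k := n / 2) (by omega) (by omega)
    have h := congrArg (Nat.cast : ℕ → ℝ) this
    push_cast [Nat.cast_sub (show 1 ≤ n by omega), Nat.cast_sub (Nat.div_le_self n 2)] at h
    exact h
  have hq : ((n - 2).choose (n / 2 - 1) : ℝ) / (n.choose (n / 2) : ℝ) =
      ((n / 2 : ℕ) * (n - (n / 2 : ℕ))) / (n * (n - 1)) := by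
    rw [div_eq_div_iff hC.ne' (by nlinarith)]
    linarith
  have h1 : 2 * ((n / 2 : ℕ) : ℝ) ≤ n := by
    exact_mod_cast (show 2 * (n / 2) ≤ n by omega)
  have h2 : (n : ℝ) ≤ 2 * ((n / 2 : ℕ) : ℝ) + 1 := by
    exact_mod_cast (show n ≤ 2 * (n / 2) + 1 by omega)
  rw [hq, Real.dist_eq, abs_le]
  have hpos : (0 : ℝ) < n * (n - 1) := by nlinarith
  have hone : 1 / ((n : ℝ) - 1) = n / (n * (n - 1)) := by
    rw [div_eq_div_iff (by linarith) hpos.ne']; ring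
  have hquarter : (1 : ℝ) / 4 = (n * (n - 1) / 4) / (n * (n - 1)) := by
    rw [eq_div_iff hpos.ne']; ring
  rw [hone, hquarter, ← sub_div, ← neg_div]
  constructor
  · exact div_le_div_of_nonneg_right (by nlinarith) hpos.le
  · exact div_le_div_of_nonneg_right (by nlinarith) hpos.le

end Binomials

section Weights

variable {n : ℕ}

theorem factorial_le_choose_mul_card_interval {A B : Finset (Fin n)} (h : A ⊆ B) :
    n.factorial ≤ (n - (B.card - A.card)).choose A.card * (precedes A Bᶜ).card := by
  have hd : Disjoint A Bᶜ := by
    rw [Finset.disjoint_left]; intro x hx; simpa using h hx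
  have := factorial_le_choose_mul_card_precedes hd
  have h1 := Finset.card_le_card h
  have h2 := Finset.card_add_card_compl B
  rw [Fintype.card_fin] at h2
  rwa [show A.card + Bᶜ.card = n - (B.card - A.card) by omega] at this

/-- An interval of dimension at least two, such as a diamond, meets as many maximal chains as one
middle set of a Boolean lattice of dimension `n - 2`. -/
theorem factorial_le_of_card_add_two_le {A B : Finset (Fin n)} (h : A ⊆ B)
    (hc : A.card + 2 ≤ B.card) :
    n.factorial ≤ (n - 2).choose (n / 2 - 1) * (precedes A Bᶜ).card := by
  have hB : B.card ≤ n := by simpa using Finset.card_le_univ B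
  exact (factorial_le_choose_mul_card_interval h).trans
    (Nat.mul_le_mul_right _ (choose_le_choose_half_pred _ (by omega)))

theorem six_mul_factorial_le_of_card_add_three_le {A B : Finset (Fin n)} (hn : 6 ≤ n) (h : A ⊆ B)
    (hc : A.card + 3 ≤ B.card) :
    6 * n.factorial ≤ 5 * (n - 2).choose (n / 2 - 1) * (precedes A Bᶜ).card := by
  have hB : B.card ≤ n := by simpa using Finset.card_le_univ B
  calc 6 * n.factorial
      ≤ 6 * ((n - (B.card - A.card)).choose A.card * (precedes A Bᶜ).card) :=
        Nat.mul_le_mul_left _ (factorial_le_choose_mul_card_interval h)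
    _ = 6 * (n - (B.card - A.card)).choose A.card * (precedes A Bᶜ).card := by ring
    _ ≤ _ := Nat.mul_le_mul_right _ (six_mul_choose_le _ hn (by omega))

theorem factorial_le_choose_mul_card_through (A : Finset (Fin n)) :
    n.factorial ≤ n.choose A.card * (precedes A Aᶜ).card := by
  simpa using factorial_le_choose_mul_card_interval (Finset.Subset.refl A)

theorem factorial_le_card_through (hn : 2 ≤ n) (A : Finset (Fin n)) :
    n.factorial ≤ 4 * (n - 2).choose (n / 2 - 1) * (precedes A Aᶜ).card :=
  (factorial_le_choose_mul_card_through A).trans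
    (Nat.mul_le_mul_right _ (choose_le_four_mul hn _))

theorem card_biUnion_through {S : Finset (Finset (Fin n))}
    (hS : ∀ A ∈ S, ∀ B ∈ S, A ≠ B → ¬ A ⊆ B) :
    (S.biUnion fun A => precedes A Aᶜ).card = ∑ A ∈ S, (precedes A Aᶜ).card :=
  Finset.card_biUnion fun A hA B hB hAB =>
    disjoint_precedes_of_not_subset (hS A hA B hB hAB) (hS B hB A hA hAB.symm)

theorem card_mul_factorial_le_of_antichain (hn : 2 ≤ n) {S : Finset (Finset (Fin n))}
    (hS : ∀ A ∈ S, ∀ B ∈ S, A ≠ B → ¬ A ⊆ B) {U : Finset (Equiv.Perm (Fin n))}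
    (hU : ∀ A ∈ S, precedes A Aᶜ ⊆ U) :
    S.card * n.factorial ≤ 4 * (n - 2).choose (n / 2 - 1) * U.card := by
  calc S.card * n.factorial = ∑ A ∈ S, n.factorial := by rw [Finset.sum_const, smul_eq_mul]
    _ ≤ ∑ A ∈ S, 4 * (n - 2).choose (n / 2 - 1) * (precedes A Aᶜ).card :=
        Finset.sum_le_sum fun A _ => factorial_le_card_through hn A
    _ = 4 * (n - 2).choose (n / 2 - 1) * (S.biUnion fun A => precedes A Aᶜ).card := by
        rw [card_biUnion_through hS, Finset.mul_sum]
    _ ≤ _ := Nat.mul_le_mul_left _ (Finset.card_le_card (Finset.biUnion_subset.2 hU))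

/-- The chains through an antichain `S` of at most seven sets, together with those through one
further set `a`, when few chains pass through both `a` and a member of `S`. -/
theorem claw_weight_of_few_common (hn : 2 ≤ n) {a : Finset (Fin n)} {S : Finset (Finset (Fin n))}
    (hS : ∀ A ∈ S, ∀ B ∈ S, A ≠ B → ¬ A ⊆ B) (h7 : S.card ≤ 7)
    {U : Finset (Equiv.Perm (Fin n))} (ha : precedes a aᶜ ⊆ U)
    (hU : ∀ A ∈ S, precedes A Aᶜ ⊆ U)
    (hfew : ∀ A ∈ S, 35 * (precedes a aᶜ ∩ precedes A Aᶜ).card ≤ (precedes a aᶜ).card) :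
    (5 * S.card + 4) * n.factorial ≤ 20 * (n - 2).choose (n / 2 - 1) * U.card := by
  set W := S.biUnion fun A => precedes A Aᶜ with hW
  have hW' : S.card * n.factorial ≤ 4 * (n - 2).choose (n / 2 - 1) * W.card :=
    card_mul_factorial_le_of_antichain hn hS fun A hA => Finset.subset_biUnion_of_mem
      (fun A => precedes A Aᶜ) hA
  have hPa := factorial_le_card_through hn a
  have hunion : (precedes a aᶜ ∪ W).card ≤ U.card :=
    Finset.card_le_card (Finset.union_subset ha (Finset.biUnion_subset.2 hU))
  have hadd := Finset.card_union_add_card_inter (precedes a aᶜ) W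
  have hinter : 35 * (precedes a aᶜ ∩ W).card ≤ 7 * (precedes a aᶜ).card := by
    rw [hW, Finset.inter_biUnion]
    calc 35 * (S.biUnion fun A => precedes a aᶜ ∩ precedes A Aᶜ).card
        ≤ 35 * ∑ A ∈ S, (precedes a aᶜ ∩ precedes A Aᶜ).card :=
          Nat.mul_le_mul_left _ Finset.card_biUnion_le
      _ = ∑ A ∈ S, 35 * (precedes a aᶜ ∩ precedes A Aᶜ).card := Finset.mul_sum _ _ _
      _ ≤ ∑ A ∈ S, (precedes a aᶜ).card := Finset.sum_le_sum hfew
      _ = S.card * (precedes a aᶜ).card := by rw [Finset.sum_const, smul_eq_mul]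
      _ ≤ 7 * (precedes a aᶜ).card := Nat.mul_le_mul_right _ h7
  have hlow : 5 * W.card + 4 * (precedes a aᶜ).card ≤ 5 * U.card := by omega
  calc (5 * S.card + 4) * n.factorial = 5 * (S.card * n.factorial) + 4 * n.factorial := by ring
    _ ≤ 5 * (4 * (n - 2).choose (n / 2 - 1) * W.card) +
          4 * (4 * (n - 2).choose (n / 2 - 1) * (precedes a aᶜ).card) := by gcongr
    _ = 4 * (n - 2).choose (n / 2 - 1) * (5 * W.card + 4 * (precedes a aᶜ).card) := by ring
    _ ≤ 4 * (n - 2).choose (n / 2 - 1) * (5 * U.card) := Nat.mul_le_mul_left _ hlow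
    _ = _ := by ring

/-- Sets far from the middle levels carry twice the weight, so that no further set is needed. -/
theorem claw_weight_of_far (hn : 2 ≤ n) {S : Finset (Finset (Fin n))}
    (hS : ∀ A ∈ S, ∀ B ∈ S, A ≠ B → ¬ A ⊆ B) (h2 : 2 ≤ S.card)
    {U : Finset (Equiv.Perm (Fin n))} (hU : ∀ A ∈ S, precedes A Aᶜ ⊆ U)
    (hfar : ∀ A ∈ S, 2 * n.choose A.card ≤ n.choose (n / 2)) :
    (5 * S.card + 4) * n.factorial ≤ 20 * (n - 2).choose (n / 2 - 1) * U.card := by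
  have hmid := choose_le_four_mul hn (n / 2)
  calc (5 * S.card + 4) * n.factorial ≤ (10 * S.card) * n.factorial :=
        Nat.mul_le_mul_right _ (by omega)
    _ = ∑ A ∈ S, 5 * (2 * n.factorial) := by rw [Finset.sum_const, smul_eq_mul]; ring
    _ ≤ ∑ A ∈ S, 5 * (4 * (n - 2).choose (n / 2 - 1) * (precedes A Aᶜ).card) := by
        refine Finset.sum_le_sum fun A hA => Nat.mul_le_mul_left _ ?_
        calc 2 * n.factorial ≤ 2 * (n.choose A.card * (precedes A Aᶜ).card) :=
              Nat.mul_le_mul_left _ (factorial_le_choose_mul_card_through A)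
          _ = 2 * n.choose A.card * (precedes A Aᶜ).card := by ring
          _ ≤ _ := Nat.mul_le_mul_right _ ((hfar A hA).trans hmid)
    _ = 20 * (n - 2).choose (n / 2 - 1) * (S.biUnion fun A => precedes A Aᶜ).card := by
        rw [card_biUnion_through hS, Finset.mul_sum]
        exact Finset.sum_congr rfl fun A _ => by ring
    _ ≤ _ := Nat.mul_le_mul_left _ (Finset.card_le_card (Finset.biUnion_subset.2 hU))

/-- A set `a` comparable to all members of a small antichain `S` contributes almost a full unit of
weight in addition to the weight of `S`. -/
theorem claw_weight (hn : 110 ≤ n) {a : Finset (Fin n)} {S : Finset (Finset (Fin n))}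
    (hS : ∀ A ∈ S, ∀ B ∈ S, A ≠ B → ¬ A ⊆ B) (h2 : 2 ≤ S.card) (h7 : S.card ≤ 7)
    (haS : ∀ A ∈ S, a ⊂ A ∨ A ⊂ a)
    {U : Finset (Equiv.Perm (Fin n))} (ha : precedes a aᶜ ⊆ U)
    (hU : ∀ A ∈ S, precedes A Aᶜ ⊆ U) :
    (5 * S.card + 4) * n.factorial ≤ 20 * (n - 2).choose (n / 2 - 1) * U.card := by
  have hn2 : 2 ≤ n := by omega
  have hother : ∀ A ∈ S, ∃ B ∈ S, B ≠ A := fun A _ => Finset.exists_mem_ne (by omega) A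
  -- Since `S` is an antichain, its members lie all above `a` or all below `a`.
  by_cases hup : ∃ A ∈ S, a ⊂ A
  · obtain ⟨A₀, hA₀, haA₀⟩ := hup
    have hall : ∀ A ∈ S, a ⊂ A := by
      intro A hA
      refine (haS A hA).resolve_right fun h => ?_
      have hss := h.trans haA₀
      exact hS A hA A₀ hA₀ hss.ne hss.subset
    -- With overlaps of proportion at most `1 / 35`, seven members of `S` take away at most a fifth
    -- of the chains through `a`. Otherwise the members of `S` have at least `n - 34` elements, and
    -- `3 * 34 + 2 ≤ n`.
    by_cases hfar : n - a.card < 35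
    · refine claw_weight_of_far hn2 hS h2 hU fun A hA => ?_
      have h1 := Finset.card_lt_card (hall A hA)
      have hAn : A.card ≤ n := by simpa using Finset.card_le_univ A
      rw [← Nat.choose_symm hAn]
      exact two_mul_choose_le_of_small (by omega)
    · refine claw_weight_of_few_common hn2 hS h7 ha hU fun A hA => ?_
      refine (Nat.mul_le_mul_right _ (Nat.le_of_not_lt hfar)).trans
        (card_precedes_inter_le (hall A hA) ?_)
      rintro rfl
      obtain ⟨B, hB, hBA⟩ := hother _ hA
      exact hS B hB _ hA hBA (Finset.subset_univ B)
  · have hall : ∀ A ∈ S, A ⊂ a := fun A hA => (haS A hA).resolve_left fun h => hup ⟨A, hA, h⟩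
    by_cases hfar : a.card < 35
    · refine claw_weight_of_far hn2 hS h2 hU fun A hA => ?_
      have h1 := Finset.card_lt_card (hall A hA)
      exact two_mul_choose_le_of_small (by omega)
    · refine claw_weight_of_few_common hn2 hS h7 ha hU fun A hA => ?_
      refine (Nat.mul_le_mul_right _ (Nat.le_of_not_lt hfar)).trans
        (card_precedes_inter_le' (hall A hA) ?_)
      rintro rfl
      obtain ⟨B, hB, hBA⟩ := hother _ hA
      exact hS _ hA B hB hBA.symm (Finset.empty_subset B)

end Weights

/-! ### Path posets, comparability graphs and the extremal family -/

section OrientedPaths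

/-- The points of a path with `m` vertices whose edges are oriented by `b`: the edge between `i` and
`i + 1` points upwards if and only if `b i` is true. -/
def OrientedPath (_b : ℕ → Bool) (m : ℕ) : Type := Fin m

/-- The order generated by the orientation: `i` is below `j` when all steps on the way from `i` to
`j` go up. -/
instance (b : ℕ → Bool) (m : ℕ) : PartialOrder (OrientedPath b m) where
  le i j := (i.val ≤ j.val ∧ ∀ k, i.val ≤ k → k < j.val → b k = true) ∨
    (j.val ≤ i.val ∧ ∀ k, j.val ≤ k → k < i.val → b k = false)
  le_refl i := Or.inl ⟨le_rfl, fun k h1 h2 => absurd h1 (by omega)⟩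
  le_trans i j l := by
    rintro (⟨h1, h2⟩ | ⟨h1, h2⟩) (⟨h3, h4⟩ | ⟨h3, h4⟩)
    · refine Or.inl ⟨h1.trans h3, fun k hk hk' => ?_⟩
      rcases Nat.lt_or_ge k j.val with h | h
      exacts [h2 k hk h, h4 k h hk']
    · rcases h1.eq_or_lt with h | h
      · rw [← h] at h3 h4; exact Or.inr ⟨h3, h4⟩
      rcases h3.eq_or_lt with h' | h'
      · rw [← h'] at h1 h2; exact Or.inl ⟨h1, h2⟩
      have := h2 (j.val - 1) (by omega) (by omega)
      have := h4 (j.val - 1) (by omega) (by omega)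
      simp_all
    · rcases h1.eq_or_lt with h | h
      · rw [h] at h3 h4; exact Or.inl ⟨h3, h4⟩
      rcases h3.eq_or_lt with h' | h'
      · rw [h'] at h1 h2; exact Or.inr ⟨h1, h2⟩
      have := h2 j.val le_rfl h
      have := h4 j.val le_rfl h'
      simp_all
    · refine Or.inr ⟨h3.trans h1, fun k hk hk' => ?_⟩
      rcases Nat.lt_or_ge k j.val with h | h
      exacts [h4 k hk h, h2 k h hk']
  le_antisymm i j := by
    rintro (⟨h1, h2⟩ | ⟨h1, h2⟩) (⟨h3, h4⟩ | ⟨h3, h4⟩)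
    · exact Fin.ext (le_antisymm h1 h3)
    · refine Fin.ext (le_antisymm h1 (Nat.le_of_not_lt fun h => ?_))
      have := h2 i.val le_rfl h
      have := h4 i.val le_rfl h
      simp_all
    · refine Fin.ext (le_antisymm (Nat.le_of_not_lt fun h => ?_) h1)
      have := h2 j.val le_rfl h
      have := h4 j.val le_rfl h
      simp_all
    · exact Fin.ext (le_antisymm h3 h1)

theorem orientedPath_le_iff {b : ℕ → Bool} {m : ℕ} {i j : OrientedPath b m} :
    i ≤ j ↔ (i.val ≤ j.val ∧ ∀ k, i.val ≤ k → k < j.val → b k = true) ∨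
      (j.val ≤ i.val ∧ ∀ k, j.val ≤ k → k < i.val → b k = false) := Iff.rfl

theorem orientedPath_val_adjacent_of_covBy {b : ℕ → Bool} {m : ℕ} {i j : OrientedPath b m}
    (h : i ⋖ j) : i.val + 1 = j.val ∨ j.val + 1 = i.val := by
  have hne : i.val ≠ j.val := fun h' => h.ne (Fin.ext h')
  have hi := i.isLt
  have hj := j.isLt
  rcases orientedPath_le_iff.1 h.le with ⟨h1, h2⟩ | ⟨h1, h2⟩
  · by_contra hcon
    let k : OrientedPath b m := ⟨i.val + 1, by omega⟩
    have hk : k.val = i.val + 1 := rfl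
    have hik : i < k := lt_of_le_of_ne
      (orientedPath_le_iff.2 (Or.inl ⟨by omega, fun l h3 h4 => h2 l h3 (by omega)⟩))
      (fun h' => by have := congrArg Fin.val h'; omega)
    have hkj : k < j := lt_of_le_of_ne
      (orientedPath_le_iff.2 (Or.inl ⟨by omega, fun l h3 h4 => h2 l (by omega) h4⟩))
      (fun h' => by have := congrArg Fin.val h'; omega)
    exact h.2 hik hkj
  · by_contra hcon
    let k : OrientedPath b m := ⟨j.val + 1, by omega⟩
    have hk : k.val = j.val + 1 := rfl
    have hik : i < k := lt_of_le_of_ne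
      (orientedPath_le_iff.2 (Or.inr ⟨by omega, fun l h3 h4 => h2 l (by omega) h4⟩))
      (fun h' => by have := congrArg Fin.val h'; omega)
    have hkj : k < j := lt_of_le_of_ne
      (orientedPath_le_iff.2 (Or.inr ⟨by omega, fun l h3 h4 => h2 l h3 (by omega)⟩))
      (fun h' => by have := congrArg Fin.val h'; omega)
    exact h.2 hik hkj

theorem orientedPath_covBy_or_covBy {b : ℕ → Bool} {m : ℕ} {i j : OrientedPath b m}
    (h : i.val + 1 = j.val) : i ⋖ j ∨ j ⋖ i := by
  have hne : i ≠ j := fun h' => by have := congrArg Fin.val h'; omega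
  have hbi : ∀ k, i.val ≤ k → k < j.val → k = i.val := fun k _ _ => by omega
  cases hb : b i.val
  · refine Or.inr ⟨lt_of_le_of_ne (orientedPath_le_iff.2
      (Or.inr ⟨by omega, fun k h1 h2 => hbi k h1 h2 ▸ hb⟩)) hne.symm, fun l hl1 hl2 => ?_⟩
    have hl3 : l.val ≠ i.val := fun h' => hl2.ne (Fin.ext h')
    have hl4 : l.val ≠ j.val := fun h' => hl1.ne (Fin.ext h'.symm)
    rcases orientedPath_le_iff.1 hl1.le with ⟨h1, h2⟩ | ⟨h1, h2⟩ <;>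
    rcases orientedPath_le_iff.1 hl2.le with ⟨h3, h4⟩ | ⟨h3, h4⟩
    · omega
    · have := h2 j.val le_rfl (by omega)
      have := h4 j.val (by omega) (by omega)
      simp_all
    · have := h2 i.val (by omega) (by omega)
      have := h4 l.val le_rfl (by omega)
      have := h2 l.val le_rfl (by omega)
      simp_all
    · omega
  · refine Or.inl ⟨lt_of_le_of_ne (orientedPath_le_iff.2
      (Or.inl ⟨by omega, fun k h1 h2 => hbi k h1 h2 ▸ hb⟩)) hne, fun l hl1 hl2 => ?_⟩
    have hl3 : l.val ≠ i.val := fun h' => hl1.ne (Fin.ext h'.symm)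
    have hl4 : l.val ≠ j.val := fun h' => hl2.ne (Fin.ext h')
    rcases orientedPath_le_iff.1 hl1.le with ⟨h1, h2⟩ | ⟨h1, h2⟩ <;>
    rcases orientedPath_le_iff.1 hl2.le with ⟨h3, h4⟩ | ⟨h3, h4⟩
    · omega
    · have := h2 j.val (by omega) (by omega)
      have := h4 j.val le_rfl (by omega)
      simp_all
    · have := h2 l.val le_rfl (by omega)
      have := h4 l.val le_rfl (by omega)
      simp_all
    · omega

theorem pathPosets_orientedPath (b : ℕ → Bool) (m : ℕ) :
    pathPosets m (OrientedPath b m) inferInstance := by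
  refine ⟨⟨Equiv.refl (Fin m), ?_⟩⟩
  intro i j
  refine Iff.trans (b := i.val + 1 = j.val ∨ j.val + 1 = i.val) SimpleGraph.pathGraph_adj
    (Iff.trans ?_ (SimpleGraph.hasse_adj (α := OrientedPath b m) (a := i) (b := j)).symm)
  constructor
  · rintro (h | h)
    · exact orientedPath_covBy_or_covBy h
    · exact (orientedPath_covBy_or_covBy h).symm
  · rintro (h | h)
    · exact orientedPath_val_adjacent_of_covBy h
    · exact (orientedPath_val_adjacent_of_covBy h).symm

variable {n : ℕ}

/-- A sequence of distinct members of `F`, each comparable to the next, is a copy of the poset of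
its ups and downs. -/
theorem not_avoidsClass_of_path {F : Finset (Finset (Fin n))} {m : ℕ} (X : ℕ → Finset (Fin n))
    (hX : ∀ i < m, X i ∈ F) (hinj : ∀ i < m, ∀ j < m, X i = X j → i = j)
    (hcomp : ∀ i, i + 1 < m → X i ⊂ X (i + 1) ∨ X (i + 1) ⊂ X i) :
    ¬ AvoidsClass (pathPosets m) F := by
  classical
  intro hav
  let b : ℕ → Bool := fun i => decide (X i ⊂ X (i + 1))
  refine hav (OrientedPath b m) inferInstance (pathPosets_orientedPath b m)
    ⟨fun i => X i.val, fun i j hij => Fin.ext (hinj _ i.isLt _ j.isLt hij),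
      fun i => hX _ i.isLt, fun i j hij => ?_⟩
  have hi := i.isLt
  have hj := j.isLt
  rcases orientedPath_le_iff.1 hij with ⟨h1, h2⟩ | ⟨h1, h2⟩
  · have : ∀ l, i.val ≤ l → l ≤ j.val → X i.val ⊆ X l := by
      intro l hl
      induction l, hl using Nat.le_induction with
      | base => exact fun _ => Finset.Subset.refl _
      | succ l hl ih =>
        intro hlj
        have := h2 l hl (by omega)
        exact (ih (by omega)).trans (of_decide_eq_true this).subset
    exact this _ h1 le_rfl
  · have : ∀ l, j.val ≤ l → l ≤ i.val → X l ⊆ X j.val := by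
      intro l hl
      induction l, hl using Nat.le_induction with
      | base => exact fun _ => Finset.Subset.refl _
      | succ l hl ih =>
        intro hli
        have := of_decide_eq_false (h2 l hl (by omega))
        exact ((hcomp l (by omega)).resolve_left this).subset.trans (ih (by omega))
    exact this _ h1 le_rfl

/-- The graph whose edges are the 2-chains of `F`; sets outside `F` are isolated vertices. -/
def comparabilityGraph (F : Finset (Finset (Fin n))) : SimpleGraph (Finset (Fin n)) where
  Adj A B := A ∈ F ∧ B ∈ F ∧ (A ⊂ B ∨ B ⊂ A)
  symm := ⟨fun _ _ h => ⟨h.2.1, h.1, h.2.2.symm⟩⟩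
  loopless := ⟨fun _ h => h.2.2.elim (fun h => h.ne rfl) (fun h => h.ne rfl)⟩

theorem fiveVertexPathFree_comparabilityGraph {F : Finset (Finset (Fin n))}
    (hF : AvoidsClass (pathPosets 5) F) : FiveVertexPathFree (comparabilityGraph F) := by
  intro a b c d e hab hbc hcd hde hac had hae hbd hbe hce
  have h1 := hab.ne
  have h2 := hbc.ne
  have h3 := hcd.ne
  have h4 := hde.ne
  refine not_avoidsClass_of_path (m := 5)
    (fun i => match i with | 0 => a | 1 => b | 2 => c | 3 => d | _ => e) ?_ ?_ ?_ hF
  · intro i hi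
    interval_cases i
    exacts [hab.1, hbc.1, hcd.1, hde.1, hde.2.1]
  · intro i hi j hj
    interval_cases i <;> interval_cases j <;> simp_all [eq_comm]
  · intro i hi
    have : i < 4 := by omega
    interval_cases i
    exacts [hab.2.2, hbc.2.2, hcd.2.2, hde.2.2]

end OrientedPaths

section PairedMiddleFamily

variable {n : ℕ}

theorem filter_eq_of_mem_pairedMiddleFamily {A B : Finset (Fin n)}
    (hA : A ∈ pairedMiddleFamily n) (hB : B ∈ pairedMiddleFamily n) (h : A ⊆ B) :
    A.filter (fun i => i.val < n - 2) = B.filter (fun i => i.val < n - 2) := by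
  simp only [pairedMiddleFamily, Finset.mem_filter, Finset.mem_univ, true_and] at hA hB
  exact Finset.eq_of_subset_of_card_le (Finset.filter_subset_filter _ h) (by omega)

theorem card_filter_not_lt_sub_two (hn : 2 ≤ n) :
    (Finset.univ.filter fun i : Fin n => ¬ i.val < n - 2).card = 2 := by
  obtain ⟨m, rfl⟩ : ∃ m, n = m + 2 := ⟨n - 2, by omega⟩
  have : (Finset.univ.filter fun i : Fin (m + 2) => ¬ i.val < m + 2 - 2) =
      {⟨m, by omega⟩, ⟨m + 1, by omega⟩} := by
    ext i
    have := i.isLt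
    simp only [Finset.mem_filter, Finset.mem_univ, true_and, Finset.mem_insert,
      Finset.mem_singleton, Fin.ext_iff]
    omega
  rw [this, Finset.card_pair]
  simp [Fin.ext_iff]

theorem card_filter_lt_sub_two (hn : 2 ≤ n) :
    (Finset.univ.filter fun i : Fin n => i.val < n - 2).card = n - 2 := by
  have h := Finset.card_filter_add_card_filter_not (s := (Finset.univ : Finset (Fin n)))
    (fun i : Fin n => i.val < n - 2)
  rw [card_filter_not_lt_sub_two hn, Finset.card_univ, Fintype.card_fin] at h
  omega

/-- Comparable members have the same trace on the first `n - 2` elements, so the members along a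
path differ only in their trace on the last two elements, which has four possible values. -/
theorem avoidsClass_pairedMiddleFamily (hn : 2 ≤ n) :
    AvoidsClass (pathPosets 5) (pairedMiddleFamily n) := by
  rintro P inst ⟨e⟩ ⟨f, hinj, hmem, hmono⟩
  let X : Fin 5 → Finset (Fin n) := fun i => f (e.symm i)
  have hstep : ∀ i j : Fin 5, (SimpleGraph.pathGraph 5).Adj i j →
      (X i).filter (fun x => x.val < n - 2) = (X j).filter (fun x => x.val < n - 2) := by
    intro i j hij
    have hadj : (SimpleGraph.hasse P).Adj (e.symm i) (e.symm j) := e.symm.map_adj_iff.2 hij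
    rw [SimpleGraph.hasse_adj] at hadj
    rcases hadj with h | h
    · exact filter_eq_of_mem_pairedMiddleFamily (hmem _) (hmem _) (hmono _ _ h.le)
    · exact (filter_eq_of_mem_pairedMiddleFamily (hmem _) (hmem _) (hmono _ _ h.le)).symm
  have h0 : ∀ i : Fin 5,
      (X i).filter (fun x => x.val < n - 2) = (X 0).filter (fun x => x.val < n - 2) := by
    have h01 := hstep 0 1 (by rw [SimpleGraph.pathGraph_adj]; simp)
    have h12 := hstep 1 2 (by rw [SimpleGraph.pathGraph_adj]; simp)
    have h23 := hstep 2 3 (by rw [SimpleGraph.pathGraph_adj]; simp)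
    have h34 := hstep 3 4 (by rw [SimpleGraph.pathGraph_adj]; simp)
    intro i
    fin_cases i
    · rfl
    · exact h01.symm
    · exact h12.symm.trans h01.symm
    · exact h23.symm.trans (h12.symm.trans h01.symm)
    · exact h34.symm.trans (h23.symm.trans (h12.symm.trans h01.symm))
  have hX : Function.Injective fun i => (X i).filter (fun x => ¬ x.val < n - 2) := by
    intro i j hij
    refine e.symm.injective (hinj ?_)
    change X i = X j
    rw [← Finset.filter_union_filter_not_eq (fun x => x.val < n - 2) (X i),
      ← Finset.filter_union_filter_not_eq (fun x => x.val < n - 2) (X j), h0 i, h0 j]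
    exact congrArg _ hij
  have hle := Finset.card_le_card_of_injOn (s := Finset.univ)
    (t := (Finset.univ.filter fun i : Fin n => ¬ i.val < n - 2).powerset)
    (fun i => (X i).filter (fun x => ¬ x.val < n - 2))
    (fun i _ => Finset.mem_coe.2 (Finset.mem_powerset.2
      (Finset.filter_subset_filter _ (Finset.subset_univ _)))) hX.injOn
  rw [Finset.card_powerset, card_filter_not_lt_sub_two hn, Finset.card_univ,
    Fintype.card_fin] at hle
  omega

theorem card_ssubset_pairs_powerset {α : Type*} [DecidableEq α] {T : Finset α} (hT : T.card = 2) :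
    ((T.powerset ×ˢ T.powerset).filter fun p => p.1 ⊂ p.2).card = 5 := by
  obtain ⟨a, b, hab, rfl⟩ := Finset.card_eq_two.1 hT
  have hfib : ∀ B ∈ ({a, b} : Finset α).powerset,
      ((({a, b} : Finset α).powerset ×ˢ ({a, b} : Finset α).powerset).filter
        fun p => p.1 ⊂ p.2 ∧ p.2 = B).card = 2 ^ B.card - 1 := by
    intro B hB
    rw [← Finset.card_powerset, ← Finset.card_erase_of_mem (Finset.mem_powerset_self B)]
    change _ = B.ssubsets.card
    refine Finset.card_bij' (fun p _ => p.1) (fun A _ => (A, B)) ?_ ?_ ?_ ?_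
    · rintro ⟨A, B'⟩ h
      simp only [Finset.mem_filter] at h
      rw [Finset.mem_ssubsets, ← h.2.2]; exact h.2.1
    · intro A hA
      rw [Finset.mem_ssubsets] at hA
      rw [Finset.mem_filter, Finset.mem_product]
      exact ⟨⟨Finset.mem_powerset.2 (hA.subset.trans (Finset.mem_powerset.1 hB)), hB⟩, hA, rfl⟩
    · rintro ⟨A, B'⟩ h
      simp only [Finset.mem_filter] at h
      simp [h.2.2]
    · intro A _; rfl
  rw [Finset.card_eq_sum_card_fiberwise (f := Prod.snd) (t := ({a, b} : Finset α).powerset)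
    (fun p hp => by
      simp only [Finset.coe_filter, Set.mem_ofPred_eq, Finset.mem_product] at hp
      exact Finset.mem_coe.2 hp.1.2)]
  simp only [Finset.filter_filter]
  rw [Finset.sum_congr rfl hfib, Finset.sum_powerset_apply_card (fun k => 2 ^ k - 1), hT]
  decide

theorem numTwoChains_pairedMiddleFamily (hn : 2 ≤ n) :
    numTwoChains (pairedMiddleFamily n) = 5 * (n - 2).choose (n / 2 - 1) := by
  have hhalf : n / 2 - 1 = (n - 2) / 2 := by omega
  set T₀ := Finset.univ.filter fun i : Fin n => i.val < n - 2 with hT₀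
  set T₁ := Finset.univ.filter fun i : Fin n => ¬ i.val < n - 2 with hT₁
  have hcard : (T₀.powersetCard ((n - 2) / 2) ×ˢ
      ((T₁.powerset ×ˢ T₁.powerset).filter fun p => p.1 ⊂ p.2)).card =
        5 * (n - 2).choose (n / 2 - 1) := by
    rw [Finset.card_product, Finset.card_powersetCard, card_filter_lt_sub_two hn,
      card_ssubset_pairs_powerset (card_filter_not_lt_sub_two hn), hhalf, mul_comm]
  have hlow : ∀ T ⊆ T₀, ∀ S ⊆ T₁, (T ∪ S).filter (fun i => i.val < n - 2) = T := by
    intro T hT S hS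
    ext x
    have h1 := @hT x
    have h2 := @hS x
    simp only [hT₀, hT₁, Finset.mem_filter, Finset.mem_univ, true_and, Finset.mem_union] at *
    tauto
  have hhigh : ∀ T ⊆ T₀, ∀ S ⊆ T₁, (T ∪ S).filter (fun i => ¬ i.val < n - 2) = S := by
    intro T hT S hS
    ext x
    have h1 := @hT x
    have h2 := @hS x
    simp only [hT₀, hT₁, Finset.mem_filter, Finset.mem_univ, true_and, Finset.mem_union] at *
    tauto
  rw [numTwoChains, ← hcard]
  refine Finset.card_bij'
    (fun p _ => (p.1.filter (fun i => i.val < n - 2),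
      (p.1.filter (fun i => ¬ i.val < n - 2), p.2.filter (fun i => ¬ i.val < n - 2))))
    (fun q _ => (q.1 ∪ q.2.1, q.1 ∪ q.2.2)) ?_ ?_ ?_ ?_
  · rintro ⟨A, B⟩ h
    simp only [Finset.mem_filter, Finset.mem_product] at h
    obtain ⟨⟨hA, hB⟩, hAB⟩ := h
    have htr := filter_eq_of_mem_pairedMiddleFamily hA hB hAB.subset
    simp only [Finset.mem_product, Finset.mem_powersetCard, Finset.mem_filter,
      Finset.mem_powerset]
    refine ⟨⟨Finset.filter_subset_filter _ (Finset.subset_univ _), ?_⟩,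
      ⟨Finset.filter_subset_filter _ (Finset.subset_univ _),
        Finset.filter_subset_filter _ (Finset.subset_univ _)⟩, ?_⟩
    · simpa [pairedMiddleFamily] using hA
    · refine (Finset.filter_subset_filter _ hAB.subset).ssubset_of_ne fun heq => hAB.ne ?_
      rw [← Finset.filter_union_filter_not_eq (fun x => x.val < n - 2) A,
        ← Finset.filter_union_filter_not_eq (fun x => x.val < n - 2) B, htr, heq]
  · rintro ⟨T, S, S'⟩ h
    simp only [Finset.mem_product, Finset.mem_powersetCard, Finset.mem_filter,
      Finset.mem_powerset] at h
    obtain ⟨⟨hT, hTc⟩, ⟨hS, hS'⟩, hSS'⟩ := h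
    simp only [Finset.mem_filter, Finset.mem_product, pairedMiddleFamily, Finset.mem_univ,
      true_and]
    refine ⟨⟨by rw [hlow T hT S hS, hTc], by rw [hlow T hT S' hS', hTc]⟩, ?_⟩
    refine (Finset.union_subset_union_right hSS'.subset).ssubset_of_ne fun heq => hSS'.ne ?_
    rw [← hhigh T hT S hS, heq, hhigh T hT S' hS']
  · rintro ⟨A, B⟩ h
    simp only [Finset.mem_filter, Finset.mem_product] at h
    have htr := filter_eq_of_mem_pairedMiddleFamily h.1.1 h.1.2 h.2.subset
    refine Prod.ext ?_ ?_
    · exact Finset.filter_union_filter_not_eq _ A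
    · simp only [htr]; exact Finset.filter_union_filter_not_eq _ B
  · rintro ⟨T, S, S'⟩ h
    simp only [Finset.mem_product, Finset.mem_powersetCard, Finset.mem_filter,
      Finset.mem_powerset] at h
    simp only [hlow T h.1.1 S h.2.1.1, hhigh T h.1.1 S h.2.1.1, hhigh T h.1.1 S' h.2.1.2]

end PairedMiddleFamily

/-! ### The upper bound -/

section UpperBound

variable {n : ℕ}

theorem exists_card_add_two_le_of_triangle {F : Finset (Finset (Fin n))} {a b c : Finset (Fin n)}
    (hab : (comparabilityGraph F).Adj a b) (hbc : (comparabilityGraph F).Adj b c)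
    (hca : (comparabilityGraph F).Adj c a) :
    ∃ A B, (A = a ∨ A = b ∨ A = c) ∧ (B = a ∨ B = b ∨ B = c) ∧ A ⊆ B ∧ A.card + 2 ≤ B.card := by
  rcases hab.2.2 with h1 | h1 <;> rcases hbc.2.2 with h2 | h2 <;> rcases hca.2.2 with h3 | h3 <;>
    have k1 := Finset.card_lt_card h1 <;> have k2 := Finset.card_lt_card h2 <;>
    have k3 := Finset.card_lt_card h3
  · omega
  · exact ⟨a, c, by simp, by simp, h3.subset, by omega⟩
  · exact ⟨c, b, by simp, by simp, h2.subset, by omega⟩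
  · exact ⟨a, b, by simp, by simp, h1.subset, by omega⟩
  · exact ⟨b, a, by simp, by simp, h1.subset, by omega⟩
  · exact ⟨b, c, by simp, by simp, h2.subset, by omega⟩
  · exact ⟨c, a, by simp, by simp, h3.subset, by omega⟩
  · omega

/-- Four pairwise comparable sets have distinct cardinalities, so two of these differ by at least
three. -/
theorem exists_card_add_three_le_of_four {F : Finset (Finset (Fin n))} {a b c d : Finset (Fin n)}
    (hab : (comparabilityGraph F).Adj a b) (hac : (comparabilityGraph F).Adj a c)
    (had : (comparabilityGraph F).Adj a d) (hbc : (comparabilityGraph F).Adj b c)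
    (hbd : (comparabilityGraph F).Adj b d) (hcd : (comparabilityGraph F).Adj c d) :
    ∃ A B, (A = a ∨ A = b ∨ A = c ∨ A = d) ∧ (B = a ∨ B = b ∨ B = c ∨ B = d) ∧ A ⊆ B ∧
      A.card + 3 ≤ B.card := by
  have hne : ∀ {x y}, (comparabilityGraph F).Adj x y → x.card ≠ y.card := by
    intro x y h
    rcases h.2.2 with h | h
    exacts [(Finset.card_lt_card h).ne, (Finset.card_lt_card h).ne']
  have hsub : ∀ {x y}, (comparabilityGraph F).Adj x y → x.card + 3 ≤ y.card → x ⊆ y := by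
    intro x y h hxy
    rcases h.2.2 with h | h
    · exact h.subset
    · have := Finset.card_lt_card h; omega
  have n1 := hne hab
  have n2 := hne hac
  have n3 := hne had
  have n4 := hne hbc
  have n5 := hne hbd
  have n6 := hne hcd
  have hex : ∀ {x y}, (comparabilityGraph F).Adj x y →
      (x = a ∨ x = b ∨ x = c ∨ x = d) → (y = a ∨ y = b ∨ y = c ∨ y = d) →
      ¬ (x.card + 3 ≤ y.card ∨ y.card + 3 ≤ x.card) ∨
      ∃ A B, (A = a ∨ A = b ∨ A = c ∨ A = d) ∧ (B = a ∨ B = b ∨ B = c ∨ B = d) ∧ A ⊆ B ∧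
        A.card + 3 ≤ B.card := by
    intro x y h hx hy
    by_cases h1 : x.card + 3 ≤ y.card
    · exact Or.inr ⟨x, y, hx, hy, hsub h h1, h1⟩
    by_cases h2 : y.card + 3 ≤ x.card
    · exact Or.inr ⟨y, x, hy, hx, hsub h.symm h2, h2⟩
    exact Or.inl (by tauto)
  by_contra hcon
  have m1 := (hex hab (by simp) (by simp)).resolve_right hcon
  have m2 := (hex hac (by simp) (by simp)).resolve_right hcon
  have m3 := (hex had (by simp) (by simp)).resolve_right hcon
  have m4 := (hex hbc (by simp) (by simp)).resolve_right hcon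
  have m5 := (hex hbd (by simp) (by simp)).resolve_right hcon
  have m6 := (hex hcd (by simp) (by simp)).resolve_right hcon
  omega

/-- Between two incomparable sets and two incomparable common supersets lies the union of the
former, which differs from all four. -/
theorem card_add_two_le_of_butterfly {a b c d : Finset (Fin n)} (hab : a ⊆ b) (had : a ⊆ d)
    (hcb : c ⊆ b) (hcd : c ⊆ d) (hca : ¬ c ⊆ a) (hbd : ¬ b ⊆ d) : a.card + 2 ≤ b.card := by
  have h1 : a.card < (a ∪ c).card := Finset.card_lt_card
    (Finset.subset_union_left.ssubset_of_ne fun h => hca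
      (by rw [h]; exact Finset.subset_union_right))
  have h2 : (b ∩ d).card < b.card := Finset.card_lt_card
    (Finset.inter_subset_left.ssubset_of_ne fun h => hbd
      (by rw [← h]; exact Finset.inter_subset_right))
  have h3 : (a ∪ c).card ≤ (b ∩ d).card := Finset.card_le_card
    (Finset.union_subset (Finset.subset_inter hab had) (Finset.subset_inter hcb hcd))
  omega

theorem exists_card_add_two_le_of_square {F : Finset (Finset (Fin n))} {a b c d : Finset (Fin n)}
    (hab : (comparabilityGraph F).Adj a b) (hbc : (comparabilityGraph F).Adj b c)
    (hcd : (comparabilityGraph F).Adj c d) (hda : (comparabilityGraph F).Adj d a)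
    (hac : a ≠ c) (hbd : b ≠ d) (hac' : ¬ (comparabilityGraph F).Adj a c)
    (hbd' : ¬ (comparabilityGraph F).Adj b d) :
    ∃ A B, (A = a ∨ A = b) ∧ (B = a ∨ B = b) ∧ A ⊆ B ∧ A.card + 2 ≤ B.card := by
  have nac : ¬ a ⊂ c := fun h => hac' ⟨hab.1, hcd.1, Or.inl h⟩
  have nca : ¬ c ⊂ a := fun h => hac' ⟨hab.1, hcd.1, Or.inr h⟩
  have nbd : ¬ b ⊂ d := fun h => hbd' ⟨hbc.1, hda.1, Or.inl h⟩
  have ndb : ¬ d ⊂ b := fun h => hbd' ⟨hbc.1, hda.1, Or.inr h⟩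
  rcases hab.2.2 with h | h
  · have hcb : c ⊂ b := hbc.2.2.resolve_left fun h' => nac (h.trans h')
    have had : a ⊂ d := hda.2.2.resolve_left fun h' => ndb (h'.trans h)
    have hcd : c ⊂ d := hcd.2.2.resolve_right fun h' => ndb (h'.trans hcb)
    exact ⟨a, b, by simp, by simp, h.subset, card_add_two_le_of_butterfly h.subset had.subset
      hcb.subset hcd.subset (fun h' => nca (h'.ssubset_of_ne hac.symm))
      (fun h' => nbd (h'.ssubset_of_ne hbd))⟩
  · have hbc : b ⊂ c := hbc.2.2.resolve_right fun h' => nca (h'.trans h)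
    have hda : d ⊂ a := hda.2.2.resolve_right fun h' => nbd (h.trans h')
    have hdc : d ⊂ c := hcd.2.2.resolve_left fun h' => nca (h'.trans hda)
    exact ⟨b, a, by simp, by simp, h.subset, card_add_two_le_of_butterfly h.subset hbc.subset
      hda.subset hdc.subset (fun h' => ndb (h'.ssubset_of_ne hbd.symm))
      (fun h' => nac (h'.ssubset_of_ne hac))⟩

open Classical in
/-- The maximal chains that meet the convex hull of the component `c` of the comparability graph:
those meeting an interval `[A, B]` with both ends in the component. -/
noncomputable def hullChains (F : Finset (Finset (Fin n)))
    (c : (comparabilityGraph F).ConnectedComponent) : Finset (Equiv.Perm (Fin n)) :=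
  Finset.univ.filter fun σ => ∃ A ∈ F, ∃ B ∈ F, (comparabilityGraph F).connectedComponentMk A = c ∧
    (comparabilityGraph F).connectedComponentMk B = c ∧ A ⊆ B ∧ σ ∈ precedes A Bᶜ

theorem connectedComponentMk_eq_of_subset {F : Finset (Finset (Fin n))} {A B : Finset (Fin n)}
    (hA : A ∈ F) (hB : B ∈ F) (h : A ⊆ B) :
    (comparabilityGraph F).connectedComponentMk A =
      (comparabilityGraph F).connectedComponentMk B := by
  rcases eq_or_ne A B with rfl | hne
  · rfl
  · rw [SimpleGraph.ConnectedComponent.eq]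
    have hadj : (comparabilityGraph F).Adj A B := ⟨hA, hB, Or.inl (h.ssubset_of_ne hne)⟩
    exact hadj.reachable

/-- A chain meeting the hulls of two components would make a member of one comparable to a member
of the other. -/
theorem disjoint_hullChains (F : Finset (Finset (Fin n)))
    {c d : (comparabilityGraph F).ConnectedComponent} (hcd : c ≠ d) :
    Disjoint (hullChains F c) (hullChains F d) := by
  rw [Finset.disjoint_left]
  intro σ hc hd
  simp only [hullChains, Finset.mem_filter, Finset.mem_univ, true_and] at hc hd
  obtain ⟨A, hA, B, hB, hAc, hBc, -, hσ⟩ := hc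
  obtain ⟨A', hA', B', hB', hAd, hBd, -, hσ'⟩ := hd
  rcases subset_or_subset_of_mem_precedes hσ hσ' with h | h
  · exact hcd (hAc.symm.trans ((connectedComponentMk_eq_of_subset hA hB' h).trans hBd))
  · exact hcd (hBc.symm.trans ((connectedComponentMk_eq_of_subset hA' hB h).symm.trans hAd))

open Classical in
/-- Each component has at most as many 2-chains as its share of the maximal chains permits, with
the diamonds `[A, A ∪ {x, y}]` as the extremal case. -/
theorem card_component_mul_factorial_le (hn : 110 ≤ n) {F : Finset (Finset (Fin n))}
    (hF : AvoidsClass (pathPosets 5) F) (c : (comparabilityGraph F).ConnectedComponent) :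
    (((F ×ˢ F).filter fun p => p.1 ⊂ p.2).filter
      fun p => (comparabilityGraph F).connectedComponentMk p.1 = c).card * n.factorial ≤
        5 * (n - 2).choose (n / 2 - 1) * (hullChains F c).card := by
  set P := ((F ×ˢ F).filter fun p => p.1 ⊂ p.2).filter
      fun p => (comparabilityGraph F).connectedComponentMk p.1 = c with hP
  set M := (n - 2).choose (n / 2 - 1) with hM
  set U := hullChains F c with hU
  have memP : ∀ p : Finset (Fin n) × Finset (Fin n), p ∈ P ↔ ((p.1 ∈ F ∧ p.2 ∈ F) ∧ p.1 ⊂ p.2) ∧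
      (comparabilityGraph F).connectedComponentMk p.1 = c := by
    intro p; simp only [hP, Finset.mem_filter, Finset.mem_product]
  rcases P.eq_empty_or_nonempty with h0 | ⟨⟨u, w⟩, huw⟩
  · rw [h0]; simp
  rw [memP] at huw
  obtain ⟨⟨⟨huF, -⟩, -⟩, huc⟩ := huw
  simp only at huF huc
  -- Strict inclusion orients every edge, so ordered pairs and edges are equinumerous.
  set E : Finset (Sym2 (Finset (Fin n))) := P.image fun p => s(p.1, p.2) with hE
  have hEcard : E.card = P.card := by
    refine Finset.card_image_of_injOn ?_
    rintro ⟨A, B⟩ hp ⟨A', B'⟩ hp' h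
    rw [Finset.mem_coe, memP] at hp hp'
    simp only [Sym2.eq_iff] at h
    rcases h with ⟨rfl, rfl⟩ | ⟨rfl, rfl⟩
    · rfl
    · exact absurd hp'.1.2 (ssubset_asymm hp.1.2)
  have hEadj : ∀ a b, s(a, b) ∈ E →
      (comparabilityGraph F).Adj a b ∧ (comparabilityGraph F).Reachable u a := by
    intro a b h
    obtain ⟨⟨A, B⟩, hp, hAB⟩ := Finset.mem_image.1 h
    rw [memP] at hp
    have hadj : (comparabilityGraph F).Adj A B := ⟨hp.1.1.1, hp.1.1.2, Or.inl hp.1.2⟩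
    have hr : (comparabilityGraph F).Reachable u A := by
      rw [← SimpleGraph.ConnectedComponent.eq, huc]; exact hp.2.symm
    simp only [Sym2.eq_iff] at hAB
    rcases hAB with ⟨rfl, rfl⟩ | ⟨rfl, rfl⟩
    · exact ⟨hadj, hr⟩
    · exact ⟨hadj.symm, hr.trans hadj.reachable⟩
  have hreachF : ∀ {x}, (comparabilityGraph F).Reachable u x → x ∈ F := fun h =>
    Finset.mem_coe.1 (mem_of_adj_closed (G := comparabilityGraph F)
      (T := (F : Set (Finset (Fin n)))) (Finset.mem_coe.2 huF)
      (fun x _ y hxy => Finset.mem_coe.2 hxy.2.1) h)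
  have hsubU : ∀ {A B}, (comparabilityGraph F).Reachable u A →
      (comparabilityGraph F).Reachable u B → A ⊆ B → precedes A Bᶜ ⊆ U := by
    intro A B hA hB hAB σ hσ
    simp only [hU, hullChains, Finset.mem_filter, Finset.mem_univ, true_and]
    exact ⟨A, hreachF hA, B, hreachF hB,
      (SimpleGraph.ConnectedComponent.eq.2 hA.symm).trans huc,
      (SimpleGraph.ConnectedComponent.eq.2 hB.symm).trans huc, hAB, hσ⟩
  have hanti : ∀ S : Finset (Finset (Fin n)), (∀ x ∈ S, (comparabilityGraph F).Reachable u x) →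
      (∀ x ∈ S, ∀ y ∈ S, ¬ (comparabilityGraph F).Adj x y) →
      ∀ A ∈ S, ∀ B ∈ S, A ≠ B → ¬ A ⊆ B := fun S hS hS' A hA B hB hAB h =>
    hS' A hA B hB ⟨hreachF (hS A hA), hreachF (hS B hB), Or.inl (h.ssubset_of_ne hAB)⟩
  -- Five edges are paid for by any interval of dimension at least two.
  have htwo : ∀ {A B}, (comparabilityGraph F).Reachable u A →
      (comparabilityGraph F).Reachable u B → A ⊆ B → A.card + 2 ≤ B.card → E.card ≤ 5 →
      P.card * n.factorial ≤ 5 * M * U.card := by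
    intro A B hA hB hAB hc h5
    calc P.card * n.factorial ≤ 5 * n.factorial := Nat.mul_le_mul_right _ (hEcard ▸ h5)
      _ ≤ 5 * (M * (precedes A Bᶜ).card) :=
          Nat.mul_le_mul_left _ (factorial_le_of_card_add_two_le hAB hc)
      _ ≤ 5 * (M * U.card) := by
          have := Finset.card_le_card (hsubU hA hB hAB)
          gcongr
      _ = 5 * M * U.card := by ring
  rcases component_structure (fiveVertexPathFree_comparabilityGraph hF) hEadj with
    ⟨a, b, c', d, hua, hab, hac, had, hbc, hbd, hcd, h6⟩ | ⟨a, b, c', hua, hab, hbc, hca, h5⟩ |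
    ⟨a, b, c', d, hua, hab, hbc, hcd, hda, hac, hbd, hac', hbd', h5⟩ | ⟨S, hS, hS', h⟩ |
    ⟨v, S, huv, hS, hS', h2, h7, h⟩
  · obtain ⟨A, B, hA, hB, hAB, hc⟩ := exists_card_add_three_le_of_four hab hac had hbc hbd hcd
    have hr : ∀ x, (x = a ∨ x = b ∨ x = c' ∨ x = d) → (comparabilityGraph F).Reachable u x := by
      rintro x (rfl | rfl | rfl | rfl)
      exacts [hua, hua.trans hab.reachable, hua.trans hac.reachable, hua.trans had.reachable]
    calc P.card * n.factorial ≤ 6 * n.factorial := Nat.mul_le_mul_right _ (hEcard ▸ h6)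
      _ ≤ 5 * M * (precedes A Bᶜ).card :=
          six_mul_factorial_le_of_card_add_three_le (by omega) hAB hc
      _ ≤ 5 * M * U.card :=
          Nat.mul_le_mul_left _ (Finset.card_le_card (hsubU (hr A hA) (hr B hB) hAB))
  · obtain ⟨A, B, hA, hB, hAB, hc⟩ := exists_card_add_two_le_of_triangle hab hbc hca
    have hr : ∀ x, (x = a ∨ x = b ∨ x = c') → (comparabilityGraph F).Reachable u x := by
      rintro x (rfl | rfl | rfl)
      exacts [hua, hua.trans hab.reachable, hua.trans hca.symm.reachable]
    exact htwo (hr A hA) (hr B hB) hAB hc h5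
  · obtain ⟨A, B, hA, hB, hAB, hc⟩ :=
      exists_card_add_two_le_of_square hab hbc hcd hda hac hbd hac' hbd'
    have hr : ∀ x, (x = a ∨ x = b) → (comparabilityGraph F).Reachable u x := by
      rintro x (rfl | rfl)
      exacts [hua, hua.trans hab.reachable]
    exact htwo (hr A hA) (hr B hB) hAB hc h5
  · have hw := card_mul_factorial_le_of_antichain (by omega) (hanti S hS hS') (U := U)
      fun A hA => hsubU (hS A hA) (hS A hA) (Finset.Subset.refl A)
    rw [hEcard] at h
    have h' := Nat.mul_le_mul_right n.factorial h
    rw [← hM] at hw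
    nlinarith
  · have hSr : ∀ x ∈ S, (comparabilityGraph F).Reachable u x :=
      fun x hx => huv.trans (hS x hx).reachable
    have hw := claw_weight hn (hanti S hSr hS') h2 h7 (a := v) (U := U)
      (fun A hA => (hS A hA).2.2) (hsubU huv huv (Finset.Subset.refl v))
      fun A hA => hsubU (hSr A hA) (hSr A hA) (Finset.Subset.refl A)
    rw [hEcard] at h
    have h' := Nat.mul_le_mul_right n.factorial h
    rw [← hM] at hw
    nlinarith

theorem numTwoChains_le_of_avoidsClass (hn : 110 ≤ n) {F : Finset (Finset (Fin n))}
    (hF : AvoidsClass (pathPosets 5) F) :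
    numTwoChains F ≤ 5 * (n - 2).choose (n / 2 - 1) := by
  classical
  set M := (n - 2).choose (n / 2 - 1) with hM
  have hsum : numTwoChains F = ∑ c : (comparabilityGraph F).ConnectedComponent,
      (((F ×ˢ F).filter fun p => p.1 ⊂ p.2).filter
        fun p => (comparabilityGraph F).connectedComponentMk p.1 = c).card := by
    rw [numTwoChains]
    exact Finset.card_eq_sum_card_fiberwise fun _ _ => Finset.mem_coe.2 (Finset.mem_univ _)
  have hU : ∑ c : (comparabilityGraph F).ConnectedComponent, (hullChains F c).card ≤
      n.factorial := by
    rw [← Finset.card_biUnion fun c _ d _ hcd => disjoint_hullChains F hcd]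
    refine (Finset.card_le_univ _).trans ?_
    rw [Fintype.card_perm, Fintype.card_fin]
  refine Nat.le_of_mul_le_mul_right ?_ n.factorial_pos
  calc numTwoChains F * n.factorial
      ≤ ∑ c : (comparabilityGraph F).ConnectedComponent, 5 * M * (hullChains F c).card := by
        rw [hsum, Finset.sum_mul]
        exact Finset.sum_le_sum fun c _ => card_component_mul_factorial_le hn hF c
    _ = 5 * M * ∑ c : (comparabilityGraph F).ConnectedComponent, (hullChains F c).card :=
        (Finset.mul_sum _ _ _).symm
    _ ≤ 5 * M * n.factorial := Nat.mul_le_mul_left _ hU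

theorem maxTwoChains_pathPosets_five (hn : 110 ≤ n) :
    maxTwoChains n (pathPosets 5) = 5 * (n - 2).choose (n / 2 - 1) := by
  classical
  refine le_antisymm (Finset.sup_le fun F hF => ?_) ?_
  · exact numTwoChains_le_of_avoidsClass hn (Finset.mem_filter.1 hF).2
  · rw [← numTwoChains_pairedMiddleFamily (n := n) (by omega)]
    exact Finset.le_sup (f := numTwoChains) (Finset.mem_filter.2
      ⟨Finset.mem_univ _, avoidsClass_pairedMiddleFamily (by omega)⟩)

end UpperBound

theorem theorem1p6 :
    (∃ N : ℕ, ∀ n : ℕ, N ≤ n →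
      maxTwoChains n (pathPosets 5) = 5 * Nat.choose (n - 2) (n / 2 - 1)) ∧
    (∃ ε : ℕ → ℝ, Tendsto ε atTop (𝓝 0) ∧ ∀ n : ℕ,
      (maxTwoChains n (pathPosets 5) : ℝ) = (5 / 4 + ε n) * (Nat.choose n (n / 2) : ℝ)) ∧
    (∀ n : ℕ, 2 ≤ n →
      AvoidsClass (pathPosets 5) (pairedMiddleFamily n) ∧
      numTwoChains (pairedMiddleFamily n) = 5 * Nat.choose (n - 2) (n / 2 - 1)) := by
  refine ⟨⟨110, fun n hn => maxTwoChains_pathPosets_five hn⟩,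
    ⟨fun n => (maxTwoChains n (pathPosets 5) : ℝ) / (n.choose (n / 2) : ℝ) - 5 / 4, ?_, ?_⟩,
    fun n hn => ⟨avoidsClass_pairedMiddleFamily hn, numTwoChains_pairedMiddleFamily hn⟩⟩
  · have h := (tendsto_choose_sub_two_div.const_mul 5).sub_const (5 / 4)
    rw [show (5 : ℝ) * (1 / 4) - 5 / 4 = 0 by norm_num] at h
    refine h.congr' ?_
    filter_upwards [eventually_ge_atTop 110] with n hn
    rw [maxTwoChains_pathPosets_five hn]
    push_cast
    ring
  · intro n
    have hC : (n.choose (n / 2) : ℝ) ≠ 0 := by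
      exact_mod_cast (Nat.choose_pos (Nat.div_le_self n 2)).ne'
    rw [add_sub_cancel, div_mul_cancel₀ _ hC]
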